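/- Let $N$ be a smooth (Hausdorff) manifold of dimension $2m$ with a symplectic form $\beta$, i.e. a smooth, closed, nondegenerate $2$-form. Let $H:N\to\mathbb R$ be a smooth function and let $w$ be its Hamiltonian vector field, defined by $i_w\beta=-dH$. Let $h\in\mathbb R$ be such that $dH(z)\neq 0$ at every point $z$ of the energy level $E_h=\{z\in N: H(z)=h\}$. Let $Y_1,Y_2\subset N$ be smooth embedded submanifolds of dimension $2m-2$ contained in $E_h$ and transverse to the flow: $w(z)\notin T_zY_i$ for all $z\in Y_i$, $i=1,2$. Neither $Y_1\cap Y_2=\emptyset$ nor $Y_1\ne Y_2$ is required; in particular $Y_1=Y_2$ is allowed. Put $\beta_i=\beta|_{Y_i}$. Let $\tau:Y_1\to(0,\infty)$ be a continuous function such that for every $z\in Y_1$ the trajectory of $w$ starting at $z$ is defined on $[0,\tau(z)]$ and is at a point $Q(z)\in Y_2$ at time $\tau(z)$ (for instance, $\tau(z)$ may be the first positive time at which the trajectory hits $Y_2$, when this time exists and depends continuously on $z$). Then $(Y_1,\beta_1)$ and $(Y_2,\beta_2)$ are symplectic manifolds, and $Q:Y_1\to Y_2$ is a symplectic map: $Q$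 is smooth and the pullback of $\beta_2$ along $Q$ is $\beta_1$ (in the notation where $Q_*$ denotes pullback, $Q_*\beta_2=\beta_1$). -/

import Mathlib

open scoped Manifold ContDiff

noncomputable section

namespace SymplecticSection

section Forms

variable {E : Type*} [NormedAddCommGroup E] [NormedSpace ℝ E]
  {M : Type*} [TopologicalSpace M] [ChartedSpace E M]
  {E' : Type*} [NormedAddCommGroup E'] [NormedSpace ℝ E']
  {M' : Type*} [TopologicalSpace M'] [ChartedSpace E' M']

/-- (Not necessarily continuous) differential 2-forms on a manifold `M` without boundary, modelled
on the normed space `E`. -/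
abbrev TwoForm (E : Type*) [NormedAddCommGroup E] [NormedSpace ℝ E]
    (M : Type*) [TopologicalSpace M] [ChartedSpace E M] : Type _ :=
  ∀ x : M, (TangentSpace 𝓘(ℝ, E) x) [⋀^Fin 2]→L[ℝ] ℝ

/-- The pullback of a 2-form along `f`:
`(pullback f η)_x (u, v) = η_{f x} (df_x u, df_x v)`. -/
def pullback (f : M → M') (η : TwoForm E' M') : TwoForm E M :=
  fun x => (η (f x)).compContinuousLinearMap (mfderiv 𝓘(ℝ, E) 𝓘(ℝ, E') f x)

/-- The coordinate expression of a 2-form in the chart around `x₀`: its pullback along the inverse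
of the chart, a 2-form on the vector space `E` (meaningful on the target of the chart). -/
def inChart (η : TwoForm E M) (x₀ : M) : E → E [⋀^Fin 2]→L[ℝ] ℝ :=
  pullback (E := E) (M := E) (extChartAt 𝓘(ℝ, E) x₀).symm η

/-- A 2-form is smooth if all its coordinate expressions are smooth. -/
def IsSmoothForm (η : TwoForm E M) : Prop :=
  ∀ x₀ : M, ContDiffOn ℝ ∞ (inChart η x₀) (extChartAt 𝓘(ℝ, E) x₀).target

/-- A 2-form is closed, `dη = 0`, if the exterior derivative of each coordinate expression
vanishes on the target of the chart. -/
def IsClosedForm (η : TwoForm E M) : Prop :=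
  ∀ x₀ : M, ∀ y ∈ (extChartAt 𝓘(ℝ, E) x₀).target, extDeriv (inChart η x₀) y = 0

/-- A 2-form is nondegenerate if `i_u η = 0` implies `u = 0`. -/
def IsNondegenerateForm (η : TwoForm E M) : Prop :=
  ∀ (x : M) (u : TangentSpace 𝓘(ℝ, E) x),
    (∀ v : TangentSpace 𝓘(ℝ, E) x, η x ![u, v] = 0) → u = 0

/-- A symplectic form: a smooth, closed, nondegenerate 2-form. -/
structure IsSymplecticForm (η : TwoForm E M) : Prop where
  smooth : IsSmoothForm η
  closed : IsClosedForm η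
  nondegenerate : IsNondegenerateForm η

/-- A smooth map `f : M → M'` is symplectic with respect to the 2-forms `η` on `M` and `η'` on `M'`
if it pulls `η'` back to `η`. -/
structure IsSymplecticMap (η : TwoForm E M) (η' : TwoForm E' M') (f : M → M') : Prop where
  smooth : ContMDiff 𝓘(ℝ, E) 𝓘(ℝ, E') ∞ f
  pullback_eq : pullback f η' = η

/-- `w` is the Hamiltonian vector field of `H` with respect to `β`: `i_w β = - dH`. -/
def IsHamiltonianVectorField (β : TwoForm E M) (H : M → ℝ)
    (w : ∀ x : M, TangentSpace 𝓘(ℝ, E) x) : Prop :=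
  ∀ (x : M) (v : TangentSpace 𝓘(ℝ, E) x), β x ![w x, v] = - mvfderiv 𝓘(ℝ, E) H x v

/-- The restriction of a 2-form on `M` to a subset `Y` carrying the structure of a manifold
modelled on `E'`: the pullback along the inclusion. -/
def restrict (E' : Type*) [NormedAddCommGroup E'] [NormedSpace ℝ E']
    (β : TwoForm E M) (Y : Set M) [ChartedSpace E' Y] : TwoForm E' Y :=
  pullback (Subtype.val : Y → M) β

/-- `Y`, with its given manifold structure modelled on `E'`, is a submanifold of `M`
contained in the level `{H = h}`, and `w z ∉ T_z Y` for all `z ∈ Y`. -/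
structure IsSection (E' : Type*) [NormedAddCommGroup E'] [NormedSpace ℝ E']
    (H : M → ℝ) (h : ℝ) (w : ∀ x : M, TangentSpace 𝓘(ℝ, E) x)
    (Y : Set M) [ChartedSpace E' Y] : Prop where
  isSmoothEmbedding :
    Manifold.IsSmoothEmbedding 𝓘(ℝ, E') 𝓘(ℝ, E) ∞ (Subtype.val : Y → M)
  subset_level : ∀ z ∈ Y, H z = h
  transverse : ∀ z : Y, w z ∉ Set.range (mfderiv 𝓘(ℝ, E') 𝓘(ℝ, E) (Subtype.val : Y → M) z)

/-- For every `z ∈ Y₁` the trajectory of `w` starting at `z` exists on `[0, τ z]`, where `τ z > 0`,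
and at time `τ z` it is at the point `Q z` of `Y₂`. (Whether it has met `Y₂` before the time `τ z`
is left open; the first positive hitting time is one possible `τ`.) -/
structure IsHittingMap (w : ∀ x : M, TangentSpace 𝓘(ℝ, E) x) (Y₁ Y₂ : Set M)
    (τ : Y₁ → ℝ) (Q : Y₁ → Y₂) : Prop where
  pos : ∀ z : Y₁, 0 < τ z
  trajectory : ∀ z : Y₁, ∃ γ : ℝ → M, γ 0 = z ∧
    IsMIntegralCurveOn (I := 𝓘(ℝ, E)) γ w (Set.Icc 0 (τ z)) ∧ γ (τ z) = Q z

end Forms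

end SymplecticSection

end

open scoped Manifold ContDiff

noncomputable section

namespace SymplecticSection

/-! ### Composition operators on spaces of continuous functions. -/

section Flow

open Set Filter Topology MeasureTheory

universe u

variable {K : Type*} [TopologicalSpace K]

/-! The Hamiltonian flow preserves `β` and `H`: since `dβ = 0` and `i_w β = -dH`, Cartan's formula
gives `L_w β = d(i_w β) = -ddH = 0`, and `dH(w) = -β(w, w) = 0`. Near a point `z₀` of `Y₁` the map
`Q` is the flow at the variable time `τ`, so `dQ(u) = dΦ(u) + dτ(u) w`, where `Φ` is the flow at the
fixed time `τ(z₀)`. In `β(dQ(u), dQ(v))` the term with `β(w, w)` vanishes, and the cross terms are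
multiples of `dH(dΦ(u))` and `dH(dΦ(v))`, which vanish because `Φ` maps `Y₁` into the level. What
remains is `β(dΦ(u), dΦ(v)) = β(u, v)`. This is `hitting_map_isSymplecticMap`.

Smoothness of `Q` reduces to smoothness of `τ`. As `w` is not tangent to `Y₂`, some local function
`g` vanishes on `Y₂` and has `dg(w) ≠ 0` (`injective_der_and_exists_function`). Then `τ` is a
continuous solution of `g(flow at time τ) = 0`, and the implicit function theorem makes it smooth
(`IsLocalFlow.contMDiffAt_transit_time`).

That the sections are symplectic is linear algebra: `T_zY ⊕ ℝw = ker dH` by dimension, and the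
radical of `β` on `ker dH` is `ℝw` (`nondegenerate_of_transverse`).

The field `w` need not be complete, so only local flows are built (`exists_isLocalFlow`), and
finitely many of them are composed along a trajectory (`exists_isTransport`). Their smooth
dependence on time and initial value comes from the implicit function theorem applied to the Picard
operator on `C([-1, 1], E)`. There the equation is rescaled to `x' = t f(x)`, so that time becomes a
parameter and all solutions live in one Banach space (`exists_smooth_flow_of_lipschitz`). -/

/-- Composition with a continuous function `f`, as a map of spaces of continuous functions. -/
def postcomp {E F : Type*} [TopologicalSpace E] [TopologicalSpace F] (f : E → F)
    (hf : Continuous f) (x : C(K, E)) : C(K, F) :=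
  (⟨f, hf⟩ : C(E, F)).comp x

@[simp]
lemma postcomp_apply {E F : Type*} [TopologicalSpace E] [TopologicalSpace F] (f : E → F)
    (hf : Continuous f) (x : C(K, E)) (s : K) : postcomp f hf x s = f (x s) := rfl

variable [CompactSpace K]

section

variable {E F : Type*} [NormedAddCommGroup E] [NormedSpace ℝ E]
  [NormedAddCommGroup F] [NormedSpace ℝ F]

variable (K E F) in
/-- The pointwise application of continuous families of linear maps to continuous families of
vectors. -/
def pointwiseApply : C(K, E →L[ℝ] F) →L[ℝ] C(K, E) →L[ℝ] C(K, F) :=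
  LinearMap.mkContinuous₂
    (LinearMap.mk₂ ℝ (fun (A : C(K, E →L[ℝ] F)) (x : C(K, E)) =>
        (⟨fun s => A s (x s), by fun_prop⟩ : C(K, F)))
      (fun _ _ _ => by ext; simp) (fun _ _ _ => by ext; simp)
      (fun _ _ _ => by ext; simp) (fun _ _ _ => by ext; simp)) 1
    (fun A x => by
      rw [one_mul, ContinuousMap.norm_le _ (by positivity)]
      intro s
      exact ((A s).le_opNorm _).trans
        (mul_le_mul (A.norm_coe_le_norm s) (x.norm_coe_le_norm s) (norm_nonneg _) (norm_nonneg A)))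

@[simp]
lemma pointwiseApply_apply (A : C(K, E →L[ℝ] F)) (x : C(K, E)) (s : K) :
    pointwiseApply K E F A x s = A s (x s) := rfl

/-- The range of `x` is compact, so `fderiv ℝ f` is uniformly continuous near it; the mean value
inequality then bounds the remainder uniformly in the parameter. -/
lemma hasFDerivAt_postcomp {f : E → F} (hf : ContDiff ℝ 1 f) (x : C(K, E)) :
    HasFDerivAt (postcomp f hf.continuous : C(K, E) → C(K, F))
      (pointwiseApply K E F (postcomp (fderiv ℝ f) (hf.continuous_fderiv one_ne_zero) x)) x := by
  rw [hasFDerivAt_iff_isLittleO_nhds_zero, Asymptotics.isLittleO_iff]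
  intro ε hε
  have hc : IsCompact (range x) := isCompact_range x.continuous
  have hu := hc.uniformContinuousAt_of_continuousAt (fderiv ℝ f)
    (fun a _ => (hf.continuous_fderiv one_ne_zero).continuousAt) (Metric.dist_mem_uniformity hε)
  obtain ⟨δ, hδ, h⟩ := Metric.mem_uniformity_dist.1 hu
  filter_upwards [Metric.ball_mem_nhds (0 : C(K, E)) hδ] with y hy
  rw [ContinuousMap.norm_le _ (by positivity)]
  intro s
  have hys : ‖y s‖ < δ := (y.norm_coe_le_norm s).trans_lt (by simpa using hy)
  have key := (convex_ball (x s) δ).norm_image_sub_le_of_norm_hasFDerivWithin_le'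
    (f := f) (f' := fderiv ℝ f) (φ := fderiv ℝ f (x s)) (C := ε) (x := x s) (y := x s + y s)
    (fun z _ => (hf.differentiable one_ne_zero z).hasFDerivAt.hasFDerivWithinAt)
    (fun z hz => by
      have := h (a := x s) (b := z) (by rw [dist_comm]; exact hz) (mem_range_self s)
      rw [← dist_eq_norm, dist_comm]
      exact le_of_lt this)
    (Metric.mem_ball_self hδ) (by simpa using hys)
  rw [add_sub_cancel_left] at key
  refine le_trans (le_of_eq ?_) (key.trans (by gcongr; exact y.norm_coe_le_norm s))
  simp

end

/-- Composition with a `C^n` function is a `C^n` map of spaces of continuous functions. -/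
lemma contDiff_postcomp_nat {E : Type u} [NormedAddCommGroup E] [NormedSpace ℝ E] (n : ℕ) :
    ∀ {F : Type u} [NormedAddCommGroup F] [NormedSpace ℝ F] {f : E → F} (hf : ContDiff ℝ n f),
      ContDiff ℝ n (postcomp f hf.continuous : C(K, E) → C(K, F)) := by
  -- The derivative of `postcomp f` is `postcomp (fderiv ℝ f)` followed by a continuous linear map.
  -- The target changes from `F` to `E →L[ℝ] F`, so the induction is over all `F`, in the universe
  -- of `E`.
  induction n with
  | zero =>
    intro F _ _ f hf
    exact contDiff_zero.2 (ContinuousMap.continuous_postcomp _)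
  | succ n ih =>
    intro F _ _ f hf
    have h1 : ContDiff ℝ 1 f := hf.of_le (by exact_mod_cast Nat.le_add_left 1 n)
    have h2 : ContDiff ℝ n (fderiv ℝ f) := hf.fderiv_right (by push_cast; rfl)
    push_cast
    rw [contDiff_succ_iff_fderiv]
    refine ⟨fun x => (hasFDerivAt_postcomp h1 x).differentiableAt, by simp, ?_⟩
    have : fderiv ℝ (postcomp f hf.continuous : C(K, E) → C(K, F)) =
        fun x => pointwiseApply K E F (postcomp (fderiv ℝ f) h2.continuous x) :=
      funext fun x => (hasFDerivAt_postcomp h1 x).fderiv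
    rw [this]
    exact (pointwiseApply K E F).contDiff.comp (ih h2)

lemma contDiff_postcomp {E F : Type u} [NormedAddCommGroup E] [NormedSpace ℝ E]
    [NormedAddCommGroup F] [NormedSpace ℝ F] {f : E → F} (hf : ContDiff ℝ ∞ f) :
    ContDiff ℝ ∞ (postcomp f hf.continuous : C(K, E) → C(K, F)) :=
  contDiff_infty.2 fun n => contDiff_postcomp_nat n (contDiff_infty.1 hf n)

/-! ### The integration operator on `C([-1, 1], E)`. -/

section Volterra

variable {E : Type*} [NormedAddCommGroup E] [NormedSpace ℝ E] 

lemma zero_mem_Icc_neg_one_one : (0 : ℝ) ∈ Icc (-1 : ℝ) 1 := by constructor <;> norm_num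

variable (E) in
/-- The primitive vanishing at `0` of a continuous function on `[-1, 1]`. -/
def primitive : C(Icc (-1 : ℝ) 1, E) →L[ℝ] C(Icc (-1 : ℝ) 1, E) :=
  LinearMap.mkContinuous
    { toFun := fun x => ⟨fun s => ∫ r in (0 : ℝ)..s, IccExtend (by norm_num) x r,
        (intervalIntegral.continuous_primitive (fun a b =>
          (x.continuous.Icc_extend' (h := by norm_num)).intervalIntegrable a b) 0).comp
            continuous_subtype_val⟩
      map_add' := fun x y => by
        ext s
        exact intervalIntegral.integral_add
          ((x.continuous.Icc_extend' (h := by norm_num)).intervalIntegrable _ _)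
          ((y.continuous.Icc_extend' (h := by norm_num)).intervalIntegrable _ _)
      map_smul' := fun c x => by
        ext s
        exact intervalIntegral.integral_smul c _ } 1
    (fun x => by
      rw [one_mul, ContinuousMap.norm_le _ (norm_nonneg _)]
      intro s
      refine (intervalIntegral.norm_integral_le_of_norm_le_const (C := ‖x‖)
        fun r _ => x.norm_coe_le_norm _).trans ?_
      have : |(s : ℝ) - 0| ≤ 1 := by rw [sub_zero]; exact abs_le.2 s.2
      nlinarith [norm_nonneg x])

lemma norm_primitive_le : ‖primitive E‖ ≤ 1 :=
  LinearMap.mkContinuous_norm_le _ zero_le_one _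

end Volterra

end Flow

/-! ### Smooth local flows in Banach spaces and in finite dimension. -/

section FlowODE

open Set Filter Topology MeasureTheory NNReal

universe u

variable {E : Type u} [NormedAddCommGroup E] [NormedSpace ℝ E]

/-- The Picard operator for the autonomous equation `x' = t f(x)`, `x(0) = p`, on `[-1, 1]`; the
parameter is the pair `(t, p)`. -/
def picardMap (f : E → E) (hf : Continuous f) (p : ℝ × E) (x : C(Icc (-1 : ℝ) 1, E)) :
    C(Icc (-1 : ℝ) 1, E) :=
  ContinuousLinearMap.const ℝ _ p.2 + p.1 • primitive E (postcomp f hf x)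

lemma picardMap_apply (f : E → E) (hf : Continuous f) (p : ℝ × E) (x : C(Icc (-1 : ℝ) 1, E))
    (s : Icc (-1 : ℝ) 1) :
    picardMap f hf p x s =
      p.2 + p.1 • ∫ r in (0 : ℝ)..s, f (IccExtend (by norm_num) x r) := rfl

/-- Integration on `[-1, 1]` from `0` has norm at most `1`, so only the factor `t` and the constant
of `f` contribute; for small `t` the operator is a contraction. -/
lemma lipschitzWith_picardMap {f : E → E} {L : ℝ≥0} (hL : LipschitzWith L f) (p : ℝ × E) :
    LipschitzWith (‖p.1‖₊ * L) (picardMap f hL.continuous p) := by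
  refine LipschitzWith.of_dist_le_mul fun x y => ?_
  have h : dist (postcomp f hL.continuous x) (postcomp f hL.continuous y) ≤ L * dist x y :=
    (ContinuousMap.dist_le (by positivity)).2 fun s =>
      (hL.dist_le_mul _ _).trans (by gcongr; exact ContinuousMap.dist_apply_le_dist s)
  rw [dist_eq_norm] at h ⊢
  have : picardMap f hL.continuous p x - picardMap f hL.continuous p y =
      p.1 • primitive E (postcomp f hL.continuous x - postcomp f hL.continuous y) := by
    simp [picardMap, smul_sub]
  rw [this, norm_smul, NNReal.coe_mul, coe_nnnorm, mul_assoc]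
  gcongr
  refine ((primitive E).le_opNorm _).trans ?_
  calc _ ≤ 1 * ‖postcomp f hL.continuous x - postcomp f hL.continuous y‖ := by
        gcongr; exact norm_primitive_le
    _ ≤ _ := by rw [one_mul]; exact h

lemma contDiff_picardMap {f : E → E} (hf : ContDiff ℝ ∞ f) :
    ContDiff ℝ ∞ fun q : (ℝ × E) × C(Icc (-1 : ℝ) 1, E) =>
      picardMap f hf.continuous q.1 q.2 :=
  ((ContinuousLinearMap.const ℝ _).contDiff.comp (contDiff_snd.comp contDiff_fst)).add
    ((contDiff_fst.comp contDiff_fst).smul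
      ((primitive E).contDiff.comp ((contDiff_postcomp hf).comp contDiff_snd)))

lemma isInvertible_one_sub {X : Type*} [NormedAddCommGroup X] [NormedSpace ℝ X] [CompleteSpace X]
    {A : X →L[ℝ] X} (hA : ‖A‖ < 1) : (1 - A).IsInvertible := by
  obtain ⟨a, ha⟩ := isUnit_one_sub_of_norm_lt_one hA
  exact ⟨ContinuousLinearEquiv.unitsEquiv ℝ X a, by ext x; rw [← ha]; rfl⟩

/-- A choice of fixed points of the Picard operator depends smoothly on the parameter. -/
lemma contDiffAt_of_picardMap_fixed [CompleteSpace E] {f : E → E} (hf : ContDiff ℝ ∞ f) {L : ℝ≥0}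
    (hL : LipschitzWith L f) {U : ℝ × E → C(Icc (-1 : ℝ) 1, E)} {S : Set (ℝ × E)} (hS : IsOpen S)
    (hSL : ∀ p ∈ S, ‖p.1‖₊ * L < 1) (hU : ∀ p ∈ S, picardMap f hL.continuous p (U p) = U p)
    {p : ℝ × E} (hp : p ∈ S) : ContDiffAt ℝ ∞ U p := by
  -- Fixed points are zeros of `G`. Its partial derivative in the function variable is `1 - D` with
  -- `‖D‖ ≤ |t| L < 1`, hence invertible.
  let G : (ℝ × E) × C(Icc (-1 : ℝ) 1, E) → C(Icc (-1 : ℝ) 1, E) :=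
    fun q => q.2 - picardMap f hL.continuous q.1 q.2
  have hG : ContDiffAt ℝ ∞ G (p, U p) := (contDiff_snd.sub (contDiff_picardMap hf)).contDiffAt
  have hT : DifferentiableAt ℝ (picardMap f hL.continuous p) (U p) :=
    ((contDiff_picardMap hf).comp (contDiff_const.prodMk contDiff_id)).differentiable
      (by simp) (U p)
  have hder : fderiv ℝ G (p, U p) ∘L .inr ℝ (ℝ × E) (C(Icc (-1 : ℝ) 1, E)) =
      1 - fderiv ℝ (picardMap f hL.continuous p) (U p) := by
    have h1 : HasFDerivAt (fun x => G (p, x))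
        (fderiv ℝ G (p, U p) ∘L .inr ℝ (ℝ × E) (C(Icc (-1 : ℝ) 1, E))) (U p) :=
      HasFDerivAt.comp (U p) (hG.differentiableAt (by simp)).hasFDerivAt
        (hasFDerivAt_prodMk_right p (U p))
    exact h1.unique ((hasFDerivAt_id _).sub hT.hasFDerivAt)
  have hinv : (fderiv ℝ G (p, U p) ∘L .inr ℝ (ℝ × E) (C(Icc (-1 : ℝ) 1, E))).IsInvertible := by
    rw [hder]
    exact isInvertible_one_sub
      ((norm_fderiv_le_of_lipschitz ℝ (lipschitzWith_picardMap hL p)).trans_lt (hSL p hp))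
  refine (hG.contDiffAt_implicitFunction (by simp) hinv).congr_of_eventuallyEq ?_
  filter_upwards [hG.eventually_apply_implicitFunction (by simp) hinv, hS.mem_nhds hp] with q hq hqS
  have h0 : G (p, U p) = 0 := sub_eq_zero.2 (hU p hp).symm
  rw [h0] at hq
  -- Uniqueness of the fixed point identifies `U` with the implicit function, so no continuity of
  -- `U` has to be known beforehand.
  have hc : ContractingWith (‖q.1‖₊ * L) (picardMap f hL.continuous q) :=
    ⟨hSL q hqS, lipschitzWith_picardMap hL q⟩
  exact hc.fixedPoint_unique' (hU q hqS) (sub_eq_zero.1 hq).symm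

/-- The solutions on `[-1, 1]` of `x' = t f(x)` for different `t` are reparametrizations of each
other. -/
lemma picardMap_fixed_rescale {f : E → E} {L : ℝ≥0} (hL : LipschitzWith L f) {t c : ℝ} {x : E}
    (ht : ‖t‖₊ * L < 1) (hc : c ∈ Icc (-1 : ℝ) 1) {u u' : C(Icc (-1 : ℝ) 1, E)}
    (hu : picardMap f hL.continuous (t, x) u = u)
    (hu' : picardMap f hL.continuous (c * t, x) u' = u') :
    u' ⟨1, by norm_num⟩ = u ⟨c, hc⟩ := by
  have hc1 : |c| ≤ 1 := abs_le.2 hc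
  have hmul : ∀ s ∈ Icc (-1 : ℝ) 1, c * s ∈ Icc (-1 : ℝ) 1 := fun s hs => by
    rw [mem_Icc, ← abs_le] at hs ⊢
    rw [abs_mul]
    exact mul_le_one₀ hc1 (abs_nonneg _) hs
  -- The curve `s ↦ u (c s)` solves the equation with parameter `c t`, by substitution in the
  -- integral; uniqueness gives `u' = w`, to be evaluated at `1`.
  let w : C(Icc (-1 : ℝ) 1, E) := ⟨fun s => u ⟨c * s, hmul s s.2⟩, by fun_prop⟩
  have hw : picardMap f hL.continuous (c * t, x) w = w := by
    ext s
    rw [picardMap_apply]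
    change _ = u ⟨c * s, hmul s s.2⟩
    rw [← hu, picardMap_apply]
    have hsub := intervalIntegral.smul_integral_comp_mul_left (a := 0) (b := s)
      (fun r => f (IccExtend (by norm_num) u r)) c
    rw [mul_zero] at hsub
    rw [← hsub, mul_comm c t, mul_smul]
    congr 3
    refine intervalIntegral.integral_congr fun r hr => ?_
    have hr' : r ∈ Icc (-1 : ℝ) 1 := ordConnected_Icc.uIcc_subset zero_mem_Icc_neg_one_one s.2 hr
    rw [IccExtend_of_mem _ _ hr', IccExtend_of_mem _ _ (hmul r hr')]
    rfl
  have hct : ‖c * t‖₊ * L < 1 := by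
    refine lt_of_le_of_lt ?_ ht
    rw [nnnorm_mul]
    gcongr
    exact mul_le_of_le_one_left zero_le hc1
  have hcw : ContractingWith (‖c * t‖₊ * L) (picardMap f hL.continuous (c * t, x)) :=
    ⟨hct, lipschitzWith_picardMap hL _⟩
  have := hcw.fixedPoint_unique' hu' hw
  rw [this]
  change u ⟨c * 1, _⟩ = _
  simp

/-- A smooth Lipschitz vector field on a Banach space has a smooth flow for a uniform time. -/
theorem exists_smooth_flow_of_lipschitz [CompleteSpace E] {f : E → E} (hf : ContDiff ℝ ∞ f)
    {L : ℝ≥0} (hL : LipschitzWith L f) :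
    ∃ δ > 0, ∃ φ : ℝ × E → E, ContDiffOn ℝ ∞ φ (Ioo (-δ) δ ×ˢ univ) ∧
      ∀ x, φ (0, x) = x ∧ ∀ t ∈ Ioo (-δ) δ, HasDerivAt (fun s => φ (s, x)) (f (φ (t, x))) t := by
  -- This ensures `|t| L < 1` for `|t| < δ`, also when `L = 0`.
  let δ : ℝ := 1 / (L + 1)
  have hδ : 0 < δ := by positivity
  have hsmall : ∀ t ∈ Ioo (-δ) δ, ‖t‖₊ * L < 1 := fun t ht => by
    have h1 : |t| < δ := abs_lt.2 ht
    rw [← NNReal.coe_lt_coe, NNReal.coe_mul, coe_nnnorm, Real.norm_eq_abs, NNReal.coe_one]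
    calc |t| * L ≤ δ * L := by gcongr
      _ < 1 := by rw [one_div_mul_eq_div, div_lt_one (by positivity)]; linarith
  have hex : ∀ p : ℝ × E, ∃ u, p.1 ∈ Ioo (-δ) δ → picardMap f hL.continuous p u = u := fun p => by
    by_cases hp : p.1 ∈ Ioo (-δ) δ
    · have hc : ContractingWith (‖p.1‖₊ * L) (picardMap f hL.continuous p) :=
        ⟨hsmall _ hp, lipschitzWith_picardMap hL p⟩
      exact ⟨hc.fixedPoint, fun _ => hc.fixedPoint_isFixedPt⟩
    · exact ⟨0, fun h => absurd h hp⟩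
  choose U hU using hex
  have hUS : ContDiffOn ℝ ∞ U (Ioo (-δ) δ ×ˢ univ) := fun p hp =>
    (contDiffAt_of_picardMap_fixed hf hL (isOpen_Ioo.prod isOpen_univ)
      (fun q hq => hsmall _ hq.1) (fun q hq => hU q hq.1) hp).contDiffWithinAt
  refine ⟨δ, hδ, fun p => U p ⟨1, by norm_num⟩,
    (ContinuousMap.evalCLM ℝ (⟨1, by norm_num⟩ : Icc (-1 : ℝ) 1) :
      C(Icc (-1 : ℝ) 1, E) →L[ℝ] E).contDiff.comp_contDiffOn hUS,
    fun x => ⟨?_, fun t ht => ?_⟩⟩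
  · have := hU (0, x) ⟨by simpa using hδ, hδ⟩
    simp only
    rw [← this, picardMap_apply]
    simp
  -- For all `s` with `|s| < t₀` the value `φ (s, x)` is read off the single solution `u` with
  -- parameter `t₀`, at `s / t₀`. The Picard equation for `u` turns this into an integral with
  -- variable end point, differentiable at `t`.
  · obtain ⟨t₀, ht₀, ht₀'⟩ := exists_between (abs_lt.2 ht)
    have ht₀pos : 0 < t₀ := (abs_nonneg t).trans_lt ht₀
    have ht₀mem : t₀ ∈ Ioo (-δ) δ := ⟨by linarith, ht₀'⟩
    set u := U (t₀, x) with hu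
    have key : ∀ s, |s| < t₀ → U (s, x) ⟨1, by norm_num⟩ =
        IccExtend (by norm_num) u (s / t₀) := fun s hs => by
      have hs' : s / t₀ ∈ Icc (-1 : ℝ) 1 := by
        rw [mem_Icc, ← abs_le, abs_div, abs_of_pos ht₀pos, div_le_one ht₀pos]
        exact hs.le
      have hst : s / t₀ * t₀ = s := div_mul_cancel₀ _ ht₀pos.ne'
      rw [IccExtend_of_mem _ _ hs']
      refine picardMap_fixed_rescale hL (hsmall _ ht₀mem) hs' (hU (t₀, x) ht₀mem) ?_
      rw [hst]
      exact hU (s, x) (abs_lt.1 (hs.trans ht₀'))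
    have key2 : ∀ s, |s| < t₀ → U (s, x) ⟨1, by norm_num⟩ =
        x + t₀ • ∫ r in (0 : ℝ)..(s / t₀), f (IccExtend (by norm_num) u r) := fun s hs => by
      have hs' : s / t₀ ∈ Icc (-1 : ℝ) 1 := by
        rw [mem_Icc, ← abs_le, abs_div, abs_of_pos ht₀pos, div_le_one ht₀pos]
        exact hs.le
      rw [key s hs, IccExtend_of_mem _ _ hs']
      conv_lhs => rw [hu, ← hU (t₀, x) ht₀mem]
      exact picardMap_apply _ _ _ _ _
    have hcont : Continuous fun r => f (IccExtend (by norm_num) u r) :=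
      hL.continuous.comp u.continuous.Icc_extend'
    have hd : HasDerivAt (fun s : ℝ => x + t₀ • ∫ r in (0 : ℝ)..(s / t₀),
        f (IccExtend (by norm_num) u r)) (t₀ • (1 / t₀) • f (IccExtend (by norm_num) u (t / t₀)))
        t := by
      refine HasDerivAt.const_add x (HasDerivAt.const_smul t₀ ?_)
      exact HasDerivAt.scomp t (hcont.integral_hasStrictDerivAt 0 (t / t₀)).hasDerivAt
        ((hasDerivAt_id t).div_const t₀)
    rw [smul_smul, mul_one_div_cancel ht₀pos.ne', one_smul, ← key t ht₀] at hd
    refine hd.congr_of_eventuallyEq ?_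
    filter_upwards [(isOpen_lt continuous_abs continuous_const).mem_nhds ht₀] with s hs
    exact key2 s hs

/-- The local flow of a vector field which is smooth on an open subset of a finite-dimensional
space is smooth. -/
theorem exists_smooth_local_flow [FiniteDimensional ℝ E] {v : E → E} {Ω : Set E} (hΩ : IsOpen Ω)
    (hv : ContDiffOn ℝ ∞ v Ω) {q : E} (hq : q ∈ Ω) :
    ∃ δ > 0, ∃ V : Set E, IsOpen V ∧ q ∈ V ∧ ∃ φ : ℝ × E → E,
      ContDiffOn ℝ ∞ φ (Ioo (-δ) δ ×ˢ V) ∧ ∀ x ∈ V, φ (0, x) = x ∧ ∀ t ∈ Ioo (-δ) δ,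
        φ (t, x) ∈ Ω ∧ HasDerivAt (fun s => φ (s, x)) (v (φ (t, x))) t := by
  have : CompleteSpace E := FiniteDimensional.complete ℝ E
  obtain ⟨r, hr, hrΩ⟩ := Metric.nhds_basis_closedBall.mem_iff.1 (hΩ.mem_nhds hq)
  let b : ContDiffBump q := ⟨r / 2, r, by positivity, by linarith⟩
  -- The cut-off field has compact support, hence is globally Lipschitz, and agrees with `v` on the
  -- ball of radius `r / 2`; time and initial set are then shrunk so that the flow stays in that
  -- ball.
  let f : E → E := fun x => b x • v x
  have hf : ContDiff ℝ ∞ f := contDiff_iff_contDiffAt.2 fun x => by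
    by_cases hx : x ∈ Ω
    · exact b.contDiff.contDiffAt.smul (hv.contDiffAt (hΩ.mem_nhds hx))
    · have hx' : x ∉ tsupport b := fun h => hx (hrΩ (by rwa [b.tsupport_eq] at h))
      refine (contDiffAt_const (c := (0 : E))).congr_of_eventuallyEq ?_
      filter_upwards [notMem_tsupport_iff_eventuallyEq.1 hx'] with y hy
      simp [f, hy]
  have hfs : HasCompactSupport f := b.hasCompactSupport.smul_right
  obtain ⟨L, hL⟩ := ContDiff.lipschitzWith_of_hasCompactSupport (𝕂 := ℝ) hfs hf (by simp)
  obtain ⟨δ, hδ, φ, hφ, hφ'⟩ := exists_smooth_flow_of_lipschitz hf hL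
  have h0 : ((0 : ℝ), q) ∈ Ioo (-δ) δ ×ˢ (univ : Set E) := ⟨⟨by linarith, hδ⟩, mem_univ _⟩
  have hcont : ContinuousAt φ (0, q) :=
    (hφ.contDiffAt ((isOpen_Ioo.prod isOpen_univ).mem_nhds h0)).continuousAt
  have hball : φ ⁻¹' Metric.ball q (r / 2) ∈ 𝓝 ((0 : ℝ), q) := by
    refine hcont.preimage_mem_nhds ?_
    rw [(hφ' q).1]
    exact Metric.ball_mem_nhds _ (by positivity)
  obtain ⟨A, hA, V, hV, hAV⟩ := mem_nhds_prod_iff.1 hball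
  obtain ⟨ε, hε, hεA⟩ := Metric.mem_nhds_iff.1 hA
  rw [Real.ball_eq_Ioo, zero_sub, zero_add] at hεA
  have hsub : Ioo (-(min δ ε)) (min δ ε) ⊆ Ioo (-δ) δ :=
    Ioo_subset_Ioo (neg_le_neg (min_le_left _ _)) (min_le_left _ _)
  have hsub' : Ioo (-(min δ ε)) (min δ ε) ⊆ A :=
    (Ioo_subset_Ioo (neg_le_neg (min_le_right _ _)) (min_le_right _ _)).trans hεA
  refine ⟨min δ ε, lt_min hδ hε, interior V, isOpen_interior, mem_interior_iff_mem_nhds.2 hV, φ,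
    hφ.mono (prod_mono hsub (subset_univ _)), fun x hx => ⟨(hφ' x).1, fun t ht => ?_⟩⟩
  have hmem : φ (t, x) ∈ Metric.ball q (r / 2) := hAV ⟨hsub' ht, interior_subset hx⟩
  have hb : b (φ (t, x)) = 1 := b.one_of_mem_closedBall (Metric.ball_subset_closedBall hmem)
  refine ⟨hrΩ (Metric.ball_subset_closedBall (Metric.ball_subset_ball (by linarith) hmem)), ?_⟩
  have := (hφ' x).2 t (hsub ht)
  simpa only [f, hb, one_smul] using this

end FlowODE

/-! ### Alternating 2-forms as bilinear forms, and smoothness of Hamiltonian fields. -/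

section LinearForms

lemma one_le_infty : (1 : WithTop ℕ∞) ≤ ∞ := WithTop.coe_le_coe.2 (le_top : (1 : ℕ∞) ≤ ⊤)

lemma two_le_infty : (2 : WithTop ℕ∞) ≤ ∞ := WithTop.coe_le_coe.2 (le_top : (2 : ℕ∞) ≤ ⊤)

lemma one_add_one_le_infty : (1 + 1 : WithTop ℕ∞) ≤ ∞ := 
  WithTop.coe_le_coe.2 (le_top : (1 + 1 : ℕ∞) ≤ ⊤)

open Set Filter Topology

variable {E : Type*} [NormedAddCommGroup E] [NormedSpace ℝ E]
  {F : Type*} [NormedAddCommGroup F] [NormedSpace ℝ F]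

variable (E) in
/-- A continuous alternating 2-form as a continuous bilinear form. -/
def toBilin : (E [⋀^Fin 2]→L[ℝ] ℝ) →L[ℝ] (E →L[ℝ] E →L[ℝ] ℝ) :=
  (ContinuousLinearMap.compL ℝ E (E [⋀^Fin 1]→L[ℝ] ℝ) (E →L[ℝ] ℝ)
    (ContinuousAlternatingMap.ofSubsingletonLIE (𝕜 := ℝ) (E := E) (F := ℝ)
      (0 : Fin 1)).symm.toContinuousLinearEquiv.toContinuousLinearMap).comp
    (ContinuousAlternatingMap.curryLeftLI (𝕜 := ℝ) (E := E) (F := ℝ)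
      (n := 1)).toContinuousLinearMap

variable (E) in
/-- The alternating part of a continuous bilinear form. -/
def alternatingPart : (E →L[ℝ] E →L[ℝ] ℝ) →L[ℝ] (E [⋀^Fin 2]→L[ℝ] ℝ) :=
  (2⁻¹ : ℝ) • (ContinuousAlternatingMap.alternatizeUncurryFinCLM ℝ E ℝ (n := 1)).comp
    (ContinuousLinearMap.compL ℝ E (E →L[ℝ] ℝ) (E [⋀^Fin 1]→L[ℝ] ℝ)
      (ContinuousAlternatingMap.ofSubsingletonLIE (𝕜 := ℝ) (E := E) (F := ℝ)
        (0 : Fin 1)).toContinuousLinearEquiv.toContinuousLinearMap)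

lemma contDiff_toBilin {n : WithTop ℕ∞} : ContDiff ℝ n (toBilin E) := by
  fun_prop

lemma contDiff_flip_compL {n : WithTop ℕ∞} :
    ContDiff ℝ n (ContinuousLinearMap.compL ℝ F E ℝ).flip := by
  fun_prop

lemma contDiff_alternatingPart {n : WithTop ℕ∞} : ContDiff ℝ n (alternatingPart E) := by
  fun_prop

@[simp]
lemma toBilin_apply (η : E [⋀^Fin 2]→L[ℝ] ℝ) (u v : E) : toBilin E η u v = η ![u, v] := by
  change η (Matrix.vecCons u fun _ => v) = _
  congr 1
  ext i; fin_cases i <;> rfl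

lemma alternating_swap (η : E [⋀^Fin 2]→L[ℝ] ℝ) (u v : E) : η ![v, u] = - η ![u, v] := by
  have := η.toAlternatingMap.map_swap ![u, v] (i := 0) (j := 1) (by decide)
  rw [show ![u, v] ∘ Equiv.swap (0 : Fin 2) 1 = ![v, u] by
    ext i; fin_cases i <;> rfl] at this
  exact this

lemma alternating_ext {η η' : E [⋀^Fin 2]→L[ℝ] ℝ} (h : ∀ u v, η ![u, v] = η' ![u, v]) :
    η = η' := by
  ext x
  rw [show x = ![x 0, x 1] by ext i; fin_cases i <;> rfl]
  exact h _ _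

lemma alternatingPart_toBilin (η : E [⋀^Fin 2]→L[ℝ] ℝ) : alternatingPart E (toBilin E η) = η := by
  refine alternating_ext fun u v => ?_
  have : alternatingPart E (toBilin E η) ![u, v] = 2⁻¹ * (η ![u, v] - η ![v, u]) := by
    simp only [alternatingPart, smul_apply, ContinuousLinearMap.comp_apply,
      ContinuousAlternatingMap.smul_apply, smul_eq_mul]
    congr 1
    change (ContinuousAlternatingMap.alternatizeUncurryFin _) ![u, v] = _
    rw [ContinuousAlternatingMap.alternatizeUncurryFin_apply, Fin.sum_univ_two]
    simp only [Fin.val_zero, pow_zero, one_smul, Fin.val_one, pow_one, neg_smul, ← sub_eq_add_neg]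
    rw [← toBilin_apply, ← toBilin_apply]
    rfl
  rw [this, alternating_swap η u v]
  ring

/-- `toBilin` has the continuous linear left inverse `alternatingPart`, so smoothness may be checked
on bilinear forms, where composition and inversion of linear maps are available. -/
lemma contDiffWithinAt_of_toBilin {f : F → E [⋀^Fin 2]→L[ℝ] ℝ} {s : Set F} {x : F}
    {n : WithTop ℕ∞} (h : ContDiffWithinAt ℝ n (fun y => toBilin E (f y)) s x) :
    ContDiffWithinAt ℝ n f s x := by
  have := contDiff_alternatingPart.comp_contDiffWithinAt h
  simpa only [Function.comp_def, alternatingPart_toBilin] using this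

lemma contDiffAt_compContinuousLinearMap {G : Type*} [NormedAddCommGroup G] [NormedSpace ℝ G]
    {f : G → E [⋀^Fin 2]→L[ℝ] ℝ} {g : G → F →L[ℝ] E} {x : G} {n : WithTop ℕ∞}
    (hf : ContDiffAt ℝ n f x) (hg : ContDiffAt ℝ n g x) :
    ContDiffAt ℝ n (fun y => (f y).compContinuousLinearMap (g y)) x := by
  refine contDiffWithinAt_of_toBilin (E := F) ?_
  have h1 : ContDiffAt ℝ n (fun y => (toBilin E (f y)).comp (g y)) x :=
    (contDiff_toBilin.contDiffAt.comp x hf).clm_comp hg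
  have h2 : ContDiffAt ℝ n (fun y => ((ContinuousLinearMap.compL ℝ F E ℝ).flip (g y)).comp
      ((toBilin E (f y)).comp (g y))) x :=
    (contDiff_flip_compL.contDiffAt.comp x hg).clm_comp h1
  refine ContDiffAt.congr_of_eventuallyEq h2 (Eventually.of_forall fun y => ?_)
  ext u v
  rw [toBilin_apply]
  simp only [ContinuousAlternatingMap.compContinuousLinearMap_apply,
    ContinuousLinearMap.comp_apply, ContinuousLinearMap.flip_apply,
    ContinuousLinearMap.compL_apply]
  rw [toBilin_apply]
  congr 1
  ext i; fin_cases i <;> rfl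

/-- The Hamiltonian vector field of a smooth function with respect to a smooth nondegenerate
2-form is smooth. -/
lemma contDiffAt_hamiltonian [FiniteDimensional ℝ E] {β : E → E [⋀^Fin 2]→L[ℝ] ℝ} {w : E → E}
    {α : E → E →L[ℝ] ℝ} {x : E} (hβ : ContDiffAt ℝ ∞ β x) (hα : ContDiffAt ℝ ∞ α x)
    (hnd : ∀ u, (∀ v, β x ![u, v] = 0) → u = 0)
    (hw : ∀ᶠ y in 𝓝 x, ∀ v, β y ![w y, v] = - α y v) : ContDiffAt ℝ ∞ w x := by
  have : CompleteSpace E := FiniteDimensional.complete ℝ E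
  -- Nondegeneracy and equality of dimensions make `u ↦ β(u, ·)` invertible at `x`, hence near `x`;
  -- there `w` is minus its inverse applied to `α`, and inversion is smooth.
  have hinj : Function.Injective (toBilin E (β x)) := by
    rw [injective_iff_map_eq_zero]
    intro u hu
    refine hnd u fun v => ?_
    rw [← toBilin_apply, hu]; rfl
  have hdim : Module.finrank ℝ E = Module.finrank ℝ (E →L[ℝ] ℝ) := by
    rw [← (LinearMap.toContinuousLinearMap (𝕜 := ℝ) (E := E) (F' := ℝ)).finrank_eq]
    exact Subspace.dual_finrank_eq.symm
  let e : E ≃L[ℝ] (E →L[ℝ] ℝ) :=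
    (LinearEquiv.ofInjectiveOfFinrankEq (toBilin E (β x)).toLinearMap hinj
      hdim).toContinuousLinearEquiv
  have he : (e : E →L[ℝ] (E →L[ℝ] ℝ)) = toBilin E (β x) := by ext; rfl
  have hb : ContDiffAt ℝ ∞ (fun y => toBilin E (β y)) x :=
    contDiff_toBilin.contDiffAt.comp x hβ
  have hi : ContDiffAt ℝ ∞ (fun y => ContinuousLinearMap.inverse (toBilin E (β y))) x := by
    have := contDiffAt_map_inverse (𝕜 := ℝ) (n := ∞) e
    rw [he] at this
    exact this.comp x hb
  have hn : ∀ᶠ y in 𝓝 x, toBilin E (β y) ∈ range ((↑) : (E ≃L[ℝ] (E →L[ℝ] ℝ)) → _) := by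
    have := ContinuousLinearEquiv.nhds e
    rw [he] at this
    exact hb.continuousAt.eventually this
  refine (hi.clm_apply hα).neg.congr_of_eventuallyEq ?_
  filter_upwards [hw, hn] with y hy hny
  obtain ⟨e', he'⟩ := hny
  have h1 : toBilin E (β y) (w y) = - α y := by ext v; rw [toBilin_apply, hy]; rfl
  rw [← map_neg, ← h1, ← he', ContinuousLinearMap.inverse_equiv]
  exact (e'.symm_apply_apply _).symm

end LinearForms

/-! ### Invariance of the form and of the Hamiltonian under the flow. -/

section FlowInvariance

open Set Filter Topology

variable {E : Type*} [NormedAddCommGroup E] [NormedSpace ℝ E]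

/-- The flow of a Hamiltonian vector field preserves the symplectic form. -/
lemma flow_preserves_form {β : E → E [⋀^Fin 2]→L[ℝ] ℝ} {H : E → ℝ} {w : E → E} {Ω V : Set E}
    (hΩ : IsOpen Ω) (hV : IsOpen V) (hβ : ContDiffOn ℝ ∞ β Ω) (hH : ContDiffOn ℝ ∞ H Ω)
    (hcl : ∀ y ∈ Ω, extDeriv β y = 0) (hw : ∀ y ∈ Ω, ∀ v, β y ![w y, v] = - fderiv ℝ H y v)
    {δ : ℝ} {φ : ℝ × E → E} (hφ : ContDiffOn ℝ ∞ φ (Ioo (-δ) δ ×ˢ V))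
    (hφ' : ∀ x ∈ V, φ (0, x) = x ∧ ∀ t ∈ Ioo (-δ) δ,
        φ (t, x) ∈ Ω ∧ HasDerivAt (fun s => φ (s, x)) (w (φ (t, x))) t)
    {x : E} (hx : x ∈ V) {t : ℝ} (ht : t ∈ Ioo (-δ) δ) (a b : E) :
    β (φ (t, x)) ![fderiv ℝ (fun y => φ (t, y)) x a, fderiv ℝ (fun y => φ (t, y)) x b] =
      β x ![a, b] := by
  have hopen : IsOpen (Ioo (-δ) δ ×ˢ V) := isOpen_Ioo.prod hV
  have hφat : ∀ p ∈ Ioo (-δ) δ ×ˢ V, ContDiffAt ℝ ∞ φ p := fun p hp =>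
    hφ.contDiffAt (hopen.mem_nhds hp)
  have hmap : ∀ p ∈ Ioo (-δ) δ ×ˢ V, φ p ∈ Ω := fun p hp => ((hφ' p.2 hp.2).2 p.1 hp.1).1
  -- Pulling `β` back along the whole flow, time included, gives a closed form `σ` on a product with
  -- `i_{∂t} σ = -dh`, where `h = H ∘ φ`. This replaces the Lie derivative.
  let σ : ℝ × E → (ℝ × E) [⋀^Fin 2]→L[ℝ] ℝ := fun p =>
    (β (φ p)).compContinuousLinearMap (fderiv ℝ φ p)
  have hσat : ∀ p ∈ Ioo (-δ) δ ×ˢ V, DifferentiableAt ℝ σ p := fun p hp =>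
    (contDiffAt_compContinuousLinearMap
      (((hβ.contDiffAt (hΩ.mem_nhds (hmap p hp))).comp p (hφat p hp)).of_le
        one_le_infty)
      ((hφat p hp).fderiv_right (m := 1) one_add_one_le_infty)).differentiableAt one_ne_zero
  have hσcl : ∀ p ∈ Ioo (-δ) δ ×ˢ V, extDeriv σ p = 0 := fun p hp => by
    have := extDeriv_pullback (r := ∞)
      ((hβ.contDiffAt (hΩ.mem_nhds (hmap p hp))).differentiableAt (by simp)) (hφat p hp)
      (by simp only [minSmoothness_of_isRCLikeNormedField]; exact two_le_infty)
    rw [hcl _ (hmap p hp)] at this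
    exact this
  have hσ2 : ∀ p u v, σ p ![u, v] = β (φ p) ![fderiv ℝ φ p u, fderiv ℝ φ p v] := fun p u v => by
    simp only [σ, ContinuousAlternatingMap.compContinuousLinearMap_apply]
    congr 1
    ext i; fin_cases i <;> rfl
  let h : ℝ × E → ℝ := fun p => H (φ p)
  have hhat : ∀ p ∈ Ioo (-δ) δ ×ˢ V, ContDiffAt ℝ ∞ h p := fun p hp =>
    (hH.contDiffAt (hΩ.mem_nhds (hmap p hp))).comp p (hφat p hp)
  have hdt : ∀ p ∈ Ioo (-δ) δ ×ˢ V, fderiv ℝ φ p (1, 0) = w (φ p) := fun p hp => by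
    have h1 : HasDerivAt (fun s => φ (s, p.2)) (fderiv ℝ φ p (1, 0)) p.1 :=
      HasFDerivAt.comp_hasDerivAt (f := fun s : ℝ => (s, p.2)) p.1
        ((hφat p hp).differentiableAt (by simp)).hasFDerivAt
        ((hasDerivAt_id p.1).prodMk (hasDerivAt_const _ _))
    exact h1.unique ((hφ' p.2 hp.2).2 p.1 hp.1).2
  have hcontr : ∀ p ∈ Ioo (-δ) δ ×ˢ V, ∀ v, σ p ![(1, 0), v] = - fderiv ℝ h p v := fun p hp v => by
    rw [hσ2, hdt p hp, hw _ (hmap p hp)]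
    have : fderiv ℝ h p = (fderiv ℝ H (φ p)).comp (fderiv ℝ φ p) :=
      fderiv_comp p ((hH.contDiffAt (hΩ.mem_nhds (hmap p hp))).differentiableAt (by simp))
        ((hφat p hp).differentiableAt (by simp))
    rw [this]; rfl
  -- Evaluating `dσ = 0` on `∂t, a, b` expresses `∂t (σ(a, b))` through derivatives of `σ(∂t, ·) =
  -- -dh`; these are second derivatives of `h`, which cancel by symmetry.
  have hstat : ∀ p ∈ Ioo (-δ) δ ×ˢ V,
      fderiv ℝ (fun q => σ q ![(0, a), (0, b)]) p (1, 0) = 0 := fun p hp => by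
    have h1 := extDeriv_apply (hσat p hp) ![((1 : ℝ), (0 : E)), (0, a), (0, b)]
    rw [hσcl p hp, Fin.sum_univ_three] at h1
    have e0 : (0 : Fin 3).removeNth ![((1 : ℝ), (0 : E)), (0, a), (0, b)] = ![(0, a), (0, b)] := by
      ext i <;> fin_cases i <;> rfl
    have e1 : (1 : Fin 3).removeNth ![((1 : ℝ), (0 : E)), (0, a), (0, b)] = ![(1, 0), (0, b)] := by
      ext i <;> fin_cases i <;> rfl
    have e2 : (2 : Fin 3).removeNth ![((1 : ℝ), (0 : E)), (0, a), (0, b)] = ![(1, 0), (0, a)] := by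
      ext i <;> fin_cases i <;> rfl
    rw [e0, e1, e2] at h1
    have hc : ∀ c d : ℝ × E, fderiv ℝ (fun q => σ q ![(1, 0), d]) p c =
        - fderiv ℝ (fderiv ℝ h) p c d := fun c d => by
      have heq : (fun q => σ q ![(1, 0), d]) =ᶠ[𝓝 p] fun q => - fderiv ℝ h q d := by
        filter_upwards [hopen.mem_nhds hp] with q hq using hcontr q hq d
      have hd : DifferentiableAt ℝ (fderiv ℝ h) p :=
        ((hhat p hp).fderiv_right (m := 1) one_add_one_le_infty).differentiableAt one_ne_zero
      rw [heq.fderiv_eq, fderiv_fun_neg, fderiv_clm_apply hd (differentiableAt_const d)]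
      simp
    have hsymm : IsSymmSndFDerivAt ℝ h p := (hhat p hp).isSymmSndFDerivAt
      (by simp only [minSmoothness_of_isRCLikeNormedField]; exact two_le_infty)
    simp only [Matrix.cons_val_zero, Matrix.cons_val_one, Matrix.cons_val, hc,
      ContinuousAlternatingMap.coe_zero, Pi.zero_apply] at h1
    rw [hsymm.eq (0, a) (0, b)] at h1
    simpa using h1.symm
  have hline : ∀ s ∈ Ioo (-δ) δ,
      HasDerivAt (fun r => σ (r, x) ![(0, a), (0, b)]) 0 s := fun s hs => by
    have h1 : HasDerivAt (fun r => σ (r, x) ![(0, a), (0, b)])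
        (fderiv ℝ (fun q => σ q ![(0, a), (0, b)]) (s, x) (1, 0)) s :=
      HasFDerivAt.comp_hasDerivAt (f := fun r : ℝ => (r, x)) s
        ((hσat (s, x) ⟨hs, hx⟩).continuousAlternatingMap_apply
          (fun i => differentiableAt_const _)).hasFDerivAt
        ((hasDerivAt_id s).prodMk (hasDerivAt_const _ _))
    rwa [hstat (s, x) ⟨hs, hx⟩] at h1
  have h0mem : (0 : ℝ) ∈ Ioo (-δ) δ := ⟨by linarith [ht.1, ht.2], by linarith [ht.1, ht.2]⟩
  have hconst : σ (t, x) ![(0, a), (0, b)] = σ (0, x) ![(0, a), (0, b)] := by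
    exact isOpen_Ioo.is_const_of_deriv_eq_zero isPreconnected_Ioo
      (fun s hs => (hline s hs).differentiableAt.differentiableWithinAt)
      (fun s hs => (hline s hs).deriv) ht h0mem
  have hslice : ∀ s ∈ Ioo (-δ) δ, ∀ c, fderiv ℝ φ (s, x) (0, c) =
      fderiv ℝ (fun y => φ (s, y)) x c := fun s hs c => by
    have h1 : HasFDerivAt (fun y => φ (s, y)) ((fderiv ℝ φ (s, x)).comp (.inr ℝ ℝ E)) x :=
      HasFDerivAt.comp x ((hφat (s, x) ⟨hs, hx⟩).differentiableAt (by simp)).hasFDerivAt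
        (hasFDerivAt_prodMk_right s x)
    rw [h1.fderiv]; rfl
  have hid : fderiv ℝ (fun y => φ (0, y)) x = ContinuousLinearMap.id ℝ E := by
    have : (fun y => φ (0, y)) =ᶠ[𝓝 x] id := by
      filter_upwards [hV.mem_nhds hx] with y hy using (hφ' y hy).1
    rw [this.fderiv_eq, fderiv_id]
  rw [hσ2, hσ2, hslice t ht, hslice t ht, hslice 0 h0mem, hslice 0 h0mem, hid,
    (hφ' x hx).1] at hconst
  exact hconst

/-- The Hamiltonian is constant along the trajectories of its vector field. -/
lemma flow_preserves_hamiltonian {β : E → E [⋀^Fin 2]→L[ℝ] ℝ} {H : E → ℝ} {w : E → E} {Ω : Set E}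
    (hΩ : IsOpen Ω) (hH : ContDiffOn ℝ ∞ H Ω)
    (hw : ∀ y ∈ Ω, ∀ v, β y ![w y, v] = - fderiv ℝ H y v)
    {δ : ℝ} {γ : ℝ → E} (hγ : ∀ t ∈ Ioo (-δ) δ, γ t ∈ Ω ∧ HasDerivAt γ (w (γ t)) t)
    {t : ℝ} (ht : t ∈ Ioo (-δ) δ) : H (γ t) = H (γ 0) := by
  have h0mem : (0 : ℝ) ∈ Ioo (-δ) δ := ⟨by linarith [ht.1, ht.2], by linarith [ht.1, ht.2]⟩
  have hline : ∀ s ∈ Ioo (-δ) δ, HasDerivAt (fun r => H (γ r)) 0 s := fun s hs => by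
    have h1 : HasDerivAt (fun r => H (γ r)) (fderiv ℝ H (γ s) (w (γ s))) s :=
      HasFDerivAt.comp_hasDerivAt s
        ((hH.contDiffAt (hΩ.mem_nhds (hγ s hs).1)).differentiableAt (by simp)).hasFDerivAt
        (hγ s hs).2
    have h2 := hw _ (hγ s hs).1 (w (γ s))
    -- `β(w, w) = 0`, hence `dH(w) = 0`.
    have h3 := alternating_swap (β (γ s)) (w (γ s)) (w (γ s))
    rwa [show fderiv ℝ H (γ s) (w (γ s)) = 0 by linarith] at h1
  exact isOpen_Ioo.is_const_of_deriv_eq_zero isPreconnected_Ioo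
    (fun s hs => (hline s hs).differentiableAt.differentiableWithinAt)
    (fun s hs => (hline s hs).deriv) ht h0mem

end FlowInvariance

/-! ### Derivatives in charts and uniqueness of integral curves. -/

section Charts

open Set Filter Topology

variable {E : Type*} [NormedAddCommGroup E] [NormedSpace ℝ E]
  {M : Type*} [TopologicalSpace M] [ChartedSpace E M]
  {E' : Type*} [NormedAddCommGroup E'] [NormedSpace ℝ E']
  {M' : Type*} [TopologicalSpace M'] [ChartedSpace E' M']
  {E'' : Type*} [NormedAddCommGroup E''] [NormedSpace ℝ E'']
  {M'' : Type*} [TopologicalSpace M''] [ChartedSpace E'' M'']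

variable (E E') in
/-- The derivative of a map between manifolds, as a map of the model spaces. -/
def der (f : M → M') (x : M) : E →L[ℝ] E' := mfderiv 𝓘(ℝ, E) 𝓘(ℝ, E') f x

/-- The value of a 2-form on a pair of tangent vectors, seen as elements of the model space. -/
def ev (η : TwoForm E M) (x : M) (u v : E) : ℝ := η x ![u, v]

lemma twoForm_ext {η η' : TwoForm E M} (h : ∀ x u v, ev η x u v = ev η' x u v) : η = η' :=
  funext fun x => alternating_ext (E := E) (h x)

lemma ev_swap (η : TwoForm E M) (x : M) (u v : E) : ev η x v u = - ev η x u v :=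
  alternating_swap (E := E) (η x) u v

lemma ev_add_left (η : TwoForm E M) (x : M) (u u' v : E) :
    ev η x (u + u') v = ev η x u v + ev η x u' v := by
  have h (a b : E) : ev η x a b = toBilin E (η x) a b := (toBilin_apply (E := E) (η x) a b).symm
  rw [h, h, h, map_add]; rfl

lemma ev_smul_left (η : TwoForm E M) (x : M) (c : ℝ) (u v : E) :
    ev η x (c • u) v = c * ev η x u v := by
  have h (a b : E) : ev η x a b = toBilin E (η x) a b := (toBilin_apply (E := E) (η x) a b).symm
  rw [h, h, map_smul]; rfl

lemma ev_add_right (η : TwoForm E M) (x : M) (u v v' : E) :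
    ev η x u (v + v') = ev η x u v + ev η x u v' := by
  rw [ev_swap, ev_add_left, ev_swap η x u v, ev_swap η x u v']; ring

lemma ev_smul_right (η : TwoForm E M) (x : M) (c : ℝ) (u v : E) :
    ev η x u (c • v) = c * ev η x u v := by
  rw [ev_swap, ev_smul_left, ev_swap η x u v]; ring

lemma ev_self (η : TwoForm E M) (x : M) (u : E) : ev η x u u = 0 := by
  linarith [ev_swap η x u u]

lemma ev_pullback (f : M → M') (η : TwoForm E' M') (x : M) (u v : E) :
    ev (pullback f η) x u v = ev η (f x) (der E E' f x u) (der E E' f x v) := by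
  change η (f x) _ = η (f x) _
  congr 1
  ext i; fin_cases i <;> rfl

lemma der_comp {g : M' → M''} {f : M → M'} {x : M}
    (hg : MDifferentiableAt 𝓘(ℝ, E') 𝓘(ℝ, E'') g (f x))
    (hf : MDifferentiableAt 𝓘(ℝ, E) 𝓘(ℝ, E') f x) :
    der E E'' (fun y => g (f y)) x = (der E' E'' g (f x)).comp (der E E' f x) :=
  mfderiv_comp x hg hf

lemma der_congr {f g : M → M'} {x : M} (h : f =ᶠ[𝓝 x] g) : der E E' f x = der E E' g x :=
  h.mfderiv_eq

lemma der_id (x : M) : der E E (fun y : M => y) x = ContinuousLinearMap.id ℝ E :=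
  mfderiv_id

lemma der_eq_fderiv (f : E → E') (x : E) : der E E' f x = fderiv ℝ f x :=
  mfderiv_eq_fderiv

variable [IsManifold 𝓘(ℝ, E) ∞ M]

lemma contMDiffAt_chart {x₀ x : M} (hx : x ∈ (extChartAt 𝓘(ℝ, E) x₀).source) :
    ContMDiffAt 𝓘(ℝ, E) 𝓘(ℝ, E) ∞ (extChartAt 𝓘(ℝ, E) x₀) x :=
  contMDiffAt_extChartAt' (by rwa [extChartAt_source] at hx)

lemma contMDiffAt_chart_symm {x₀ : M} {y : E} (hy : y ∈ (extChartAt 𝓘(ℝ, E) x₀).target) :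
    ContMDiffAt 𝓘(ℝ, E) 𝓘(ℝ, E) ∞ (extChartAt 𝓘(ℝ, E) x₀).symm y :=
  (contMDiffOn_extChartAt_symm x₀).contMDiffAt ((isOpen_extChartAt_target x₀).mem_nhds hy)

lemma der_symm_der_chart {x₀ x : M} (hx : x ∈ (extChartAt 𝓘(ℝ, E) x₀).source) (u : E) :
    der E E (extChartAt 𝓘(ℝ, E) x₀).symm (extChartAt 𝓘(ℝ, E) x₀ x)
      (der E E (extChartAt 𝓘(ℝ, E) x₀) x u) = u := by
  have h := der_comp ((contMDiffAt_chart_symm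
    ((extChartAt 𝓘(ℝ, E) x₀).map_source hx)).mdifferentiableAt (by simp))
    ((contMDiffAt_chart hx).mdifferentiableAt (by simp))
  have h2 : (fun y => (extChartAt 𝓘(ℝ, E) x₀).symm (extChartAt 𝓘(ℝ, E) x₀ y)) =ᶠ[𝓝 x]
      fun y => y := by
    filter_upwards [(isOpen_extChartAt_source x₀).mem_nhds hx] with y hy
    exact (extChartAt 𝓘(ℝ, E) x₀).left_inv hy
  rw [der_congr h2, der_id] at h
  exact (congrArg (fun A : E →L[ℝ] E => A u) h).symm

lemma der_der_chart_symm {x₀ : M} {y : E} (hy : y ∈ (extChartAt 𝓘(ℝ, E) x₀).target) (u : E) :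
    der E E (extChartAt 𝓘(ℝ, E) x₀) ((extChartAt 𝓘(ℝ, E) x₀).symm y)
      (der E E (extChartAt 𝓘(ℝ, E) x₀).symm y u) = u := by
  have h := der_comp ((contMDiffAt_chart
    ((extChartAt 𝓘(ℝ, E) x₀).map_target hy)).mdifferentiableAt (by simp))
    ((contMDiffAt_chart_symm hy).mdifferentiableAt (by simp))
  have h2 : (fun z => extChartAt 𝓘(ℝ, E) x₀ ((extChartAt 𝓘(ℝ, E) x₀).symm z)) =ᶠ[𝓝 y]
      fun z => z := by
    filter_upwards [(isOpen_extChartAt_target x₀).mem_nhds hy] with z hz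
    exact (extChartAt 𝓘(ℝ, E) x₀).right_inv hz
  rw [der_congr h2, der_id] at h
  exact (congrArg (fun A : E →L[ℝ] E => A u) h).symm

lemma der_symm_der_chart' {x₀ : M} {y : E} (hy : y ∈ (extChartAt 𝓘(ℝ, E) x₀).target) (u : E) :
    der E E (extChartAt 𝓘(ℝ, E) x₀).symm y
      (der E E (extChartAt 𝓘(ℝ, E) x₀) ((extChartAt 𝓘(ℝ, E) x₀).symm y) u) = u := by
  have h := der_symm_der_chart ((extChartAt 𝓘(ℝ, E) x₀).map_target hy) u
  rwa [(extChartAt 𝓘(ℝ, E) x₀).right_inv hy] at h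

/-- A vector field, in the chart around `x₀`. -/
def fieldInChart (w : M → E) (x₀ : M) (y : E) : E :=
  der E E (extChartAt 𝓘(ℝ, E) x₀) ((extChartAt 𝓘(ℝ, E) x₀).symm y)
    (w ((extChartAt 𝓘(ℝ, E) x₀).symm y))

/-- A function, in the chart around `x₀`. -/
def funInChart (E : Type*) [NormedAddCommGroup E] [NormedSpace ℝ E] [ChartedSpace E M]
    (H : M → ℝ) (x₀ : M) (y : E) : ℝ := H ((extChartAt 𝓘(ℝ, E) x₀).symm y)

lemma contDiffOn_funInChart {H : M → ℝ} (hH : ContMDiff 𝓘(ℝ, E) 𝓘(ℝ, ℝ) ∞ H) (x₀ : M) :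
    ContDiffOn ℝ ∞ (funInChart E H x₀) (extChartAt 𝓘(ℝ, E) x₀).target :=
  (hH.comp_contMDiffOn (contMDiffOn_extChartAt_symm x₀)).contDiffOn

lemma inChart_field {β : TwoForm E M} {H : M → ℝ} {w : M → E}
    (hH : ContMDiff 𝓘(ℝ, E) 𝓘(ℝ, ℝ) ∞ H)
    (hw : ∀ x u, ev β x (w x) u = - der E ℝ H x u) {x₀ : M} {y : E}
    (hy : y ∈ (extChartAt 𝓘(ℝ, E) x₀).target) (v : E) :
    inChart β x₀ y ![fieldInChart w x₀ y, v] = - fderiv ℝ (funInChart E H x₀) y v := by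
  have h1 : inChart β x₀ y ![fieldInChart w x₀ y, v] = ev β ((extChartAt 𝓘(ℝ, E) x₀).symm y)
      (der E E (extChartAt 𝓘(ℝ, E) x₀).symm y (fieldInChart w x₀ y))
      (der E E (extChartAt 𝓘(ℝ, E) x₀).symm y v) :=
    ev_pullback (M := E) (E := E) (extChartAt 𝓘(ℝ, E) x₀).symm β y _ _
  rw [h1, fieldInChart, der_symm_der_chart' hy, hw, ← der_eq_fderiv]
  have h2 : der E ℝ (funInChart E H x₀) y = _ :=
    der_comp (g := H) (f := (extChartAt 𝓘(ℝ, E) x₀).symm) (hH.mdifferentiableAt (by simp))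
      ((contMDiffAt_chart_symm hy).mdifferentiableAt (by simp))
  rw [h2]
  rfl

/-- In a chart the Hamiltonian equation keeps its form, with a form that is still nondegenerate
because the chart has invertible derivative; so `contDiffAt_hamiltonian` applies. -/
lemma contDiffOn_fieldInChart [FiniteDimensional ℝ E] {β : TwoForm E M} (hβ : IsSmoothForm β)
    (hnd : ∀ x u, (∀ v, ev β x u v = 0) → u = 0) {H : M → ℝ} {w : M → E}
    (hH : ContMDiff 𝓘(ℝ, E) 𝓘(ℝ, ℝ) ∞ H)
    (hw : ∀ x u, ev β x (w x) u = - der E ℝ H x u) (x₀ : M) :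
    ContDiffOn ℝ ∞ (fieldInChart w x₀) (extChartAt 𝓘(ℝ, E) x₀).target := by
  intro y hy
  have hyn := (isOpen_extChartAt_target (I := 𝓘(ℝ, E)) x₀).mem_nhds hy
  refine (contDiffAt_hamiltonian (β := inChart β x₀) (α := fderiv ℝ (funInChart E H x₀))
    ((hβ x₀).contDiffAt hyn)
    (((contDiffOn_funInChart hH x₀).contDiffAt hyn).fderiv_right (by simp)) ?_ ?_).contDiffWithinAt
  · intro u hu
    have h1 : der E E (extChartAt 𝓘(ℝ, E) x₀).symm y u = 0 := by
      refine hnd ((extChartAt 𝓘(ℝ, E) x₀).symm y) _ fun v => ?_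
      rw [← der_symm_der_chart' hy v,
        ← ev_pullback (M := E) (E := E) (extChartAt 𝓘(ℝ, E) x₀).symm β y]
      exact hu _
    rw [← der_der_chart_symm hy u, h1, map_zero]
  · filter_upwards [hyn] with z hz v using inChart_field hH hw hz v

/-- The linear map `ℝ → E` sending `1` to the given vector. -/
def velocity (u : E) : ℝ →L[ℝ] E := (1 : ℝ →L[ℝ] ℝ).smulRight u

lemma velocity_apply (u : E) (t : ℝ) : velocity u t = t • u := by
  simp [velocity]

/-- An integral curve, in the chart around `x₀`. -/
lemma hasDerivWithinAt_chart {w : M → E} {γ : ℝ → M} {s : Set ℝ} {t : ℝ}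
    (hγ : HasMFDerivWithinAt 𝓘(ℝ, ℝ) 𝓘(ℝ, E) γ s t (velocity (E := E) (w (γ t))))
    {x₀ : M} (ht : γ t ∈ (extChartAt 𝓘(ℝ, E) x₀).source) :
    HasDerivWithinAt (fun r => extChartAt 𝓘(ℝ, E) x₀ (γ r))
      (fieldInChart w x₀ (extChartAt 𝓘(ℝ, E) x₀ (γ t))) s t := by
  have h1 : HasMFDerivWithinAt 𝓘(ℝ, ℝ) 𝓘(ℝ, E) (fun r => extChartAt 𝓘(ℝ, E) x₀ (γ r)) s t
      ((der E E (extChartAt 𝓘(ℝ, E) x₀) (γ t)).comp (velocity (E := E) (w (γ t)))) :=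
    ((contMDiffAt_chart ht).mdifferentiableAt (by simp)).hasMFDerivAt.comp_hasMFDerivWithinAt t hγ
  have h2 : HasFDerivWithinAt (fun r => extChartAt 𝓘(ℝ, E) x₀ (γ r))
      ((der E E (extChartAt 𝓘(ℝ, E) x₀) (γ t)).comp (velocity (E := E) (w (γ t)))) s t :=
    hasMFDerivWithinAt_iff_hasFDerivWithinAt.1 h1
  have h2 := h2.hasDerivWithinAt
  rw [fieldInChart, (extChartAt 𝓘(ℝ, E) x₀).left_inv ht]
  rwa [ContinuousLinearMap.comp_apply, velocity_apply, one_smul] at h2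

/-- Uniqueness of integral curves with a given initial value on a closed interval. -/
lemma integralCurve_unique [T2Space M] {w : M → E}
    (hw : ∀ x₀ : M, ContDiffOn ℝ ∞ (fieldInChart w x₀) (extChartAt 𝓘(ℝ, E) x₀).target)
    {η ζ : ℝ → M} {a b : ℝ}
    (hη : ∀ t ∈ Icc a b, HasMFDerivWithinAt 𝓘(ℝ, ℝ) 𝓘(ℝ, E) η (Icc a b) t
      (velocity (E := E) (w (η t))))
    (hζ : ∀ t ∈ Icc a b, HasMFDerivWithinAt 𝓘(ℝ, ℝ) 𝓘(ℝ, E) ζ (Icc a b) t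
      (velocity (E := E) (w (ζ t))))
    (h0 : η a = ζ a) : ∀ t ∈ Icc a b, η t = ζ t := by
  have hηc : ContinuousOn η (Icc a b) := fun t ht => (hη t ht).1
  have hζc : ContinuousOn ζ (Icc a b) := fun t ht => (hζ t ht).1
  have hcl : IsClosed ({t | η t = ζ t} ∩ Icc a b) := by
    rw [inter_comm]
    exact (hηc.prodMk hζc).preimage_isClosed_of_isClosed isClosed_Icc isClosed_diagonal
  -- The set of agreement is closed by the Hausdorff property. It remains to extend agreement to the
  -- right of each of its points, by uniqueness for a locally Lipschitz field in a chart.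
  refine hcl.Icc_subset_of_forall_mem_nhdsWithin h0 fun t ⟨hts, hta, htb⟩ => ?_
  have htI : t ∈ Icc a b := ⟨hta, htb.le⟩
  set χ := extChartAt 𝓘(ℝ, E) (η t) with hχ
  have hsrc : η t ∈ χ.source := mem_extChartAt_source (η t)
  have hsrcn : χ.source ∈ 𝓝 (η t) := extChartAt_source_mem_nhds (η t)
  obtain ⟨L, S, hS, hL⟩ := (((hw (η t)).contDiffAt ((isOpen_extChartAt_target (η t)).mem_nhds
    (χ.map_source hsrc))).of_le one_le_infty).exists_lipschitzOnWith
  have hχn : χ ⁻¹' S ∩ χ.source ∈ 𝓝 (η t) :=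
    inter_mem ((continuousAt_extChartAt (η t)).preimage_mem_nhds hS) hsrcn
  have hη1 : η ⁻¹' (χ ⁻¹' S ∩ χ.source) ∈ 𝓝[Icc a b] t := hηc t htI hχn
  have hζ1 : ζ ⁻¹' (χ ⁻¹' S ∩ χ.source) ∈ 𝓝[Icc a b] t :=
    hζc t htI (by rw [← show η t = ζ t from hts]; exact hχn)
  have hle : 𝓝[≥] t ≤ 𝓝[Icc a b] t :=
    nhdsWithin_le_iff.2 (mem_of_superset (Icc_mem_nhdsGE htb) (Icc_subset_Icc_left hta))
  obtain ⟨c, hc, hcsub⟩ := (mem_nhdsGE_iff_exists_Icc_subset).1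
    (inter_mem (Icc_mem_nhdsGE htb) (hle (inter_mem hη1 hζ1)))
  have htc : t < c := hc
  have hIcc : Icc t c ⊆ Icc a b := fun r hr => ⟨hta.trans hr.1, (hcsub hr).1.2⟩
  have hIci : ∀ r ∈ Ico t c, Icc a b ∈ 𝓝[≥] r := fun r hr =>
    mem_of_superset (Icc_mem_nhdsGE (hr.2.trans_le (hIcc (right_mem_Icc.2 htc.le)).2))
      (Icc_subset_Icc_left (hta.trans hr.1))
  have key := ODE_solution_unique_of_mem_Icc_right (v := fun _ => fieldInChart w (η t))
    (s := fun _ => S) (K := L) (f := fun r => χ (η r)) (g := fun r => χ (ζ r)) (a := t) (b := c)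
    (fun _ _ => hL)
    (fun r hr => ((continuousAt_extChartAt' (hcsub hr).2.1.2).comp_continuousWithinAt
      ((hηc r (hIcc hr)).mono hIcc)))
    (fun r hr => (hasDerivWithinAt_chart (hη r (hIcc (Ico_subset_Icc_self hr)))
      (hcsub (Ico_subset_Icc_self hr)).2.1.2).mono_of_mem_nhdsWithin (hIci r hr))
    (fun r hr => (hcsub (Ico_subset_Icc_self hr)).2.1.1)
    (fun r hr => ((continuousAt_extChartAt' (hcsub hr).2.2.2).comp_continuousWithinAt
      ((hζc r (hIcc hr)).mono hIcc)))
    (fun r hr => (hasDerivWithinAt_chart (hζ r (hIcc (Ico_subset_Icc_self hr)))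
      (hcsub (Ico_subset_Icc_self hr)).2.2.2).mono_of_mem_nhdsWithin (hIci r hr))
    (fun r hr => (hcsub (Ico_subset_Icc_self hr)).2.2.1)
    (congrArg χ hts)
  refine mem_of_superset (Icc_mem_nhdsGT htc) fun r hr => ?_
  exact χ.injOn (hcsub hr).2.1.2 (hcsub hr).2.2.2 (key hr)

end Charts

/-! ### Smooth symplectic local flows on the manifold. -/

section LocalFlow

open Set Filter Topology

variable {E : Type*} [NormedAddCommGroup E] [NormedSpace ℝ E]
  {M : Type*} [TopologicalSpace M] [ChartedSpace E M]
  {E' : Type*} [NormedAddCommGroup E'] [NormedSpace ℝ E']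
  {M' : Type*} [TopologicalSpace M'] [ChartedSpace E' M']
  {E'' : Type*} [NormedAddCommGroup E''] [NormedSpace ℝ E'']
  {M'' : Type*} [TopologicalSpace M''] [ChartedSpace E'' M'']

/-- The chain rule for a map depending on a real parameter. -/
lemma der_comp_prod {φ : ℝ × M' → M''} {s : M → ℝ} {f : M → M'} {z : M}
    (hφ : MDifferentiableAt (𝓘(ℝ, ℝ).prod 𝓘(ℝ, E')) 𝓘(ℝ, E'') φ (s z, f z))
    (hs : MDifferentiableAt 𝓘(ℝ, E) 𝓘(ℝ, ℝ) s z)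
    (hf : MDifferentiableAt 𝓘(ℝ, E) 𝓘(ℝ, E') f z) (u : E) :
    der E E'' (fun p => φ (s p, f p)) z u =
      der E' E'' (fun x => φ (s z, x)) (f z) (der E E' f z u) +
        der ℝ E'' (fun r => φ (r, f z)) (s z) (der E ℝ s z u) := by
  obtain ⟨A, hA⟩ : ∃ A : ℝ × E' →L[ℝ] E'',
      HasMFDerivAt (𝓘(ℝ, ℝ).prod 𝓘(ℝ, E')) 𝓘(ℝ, E'') φ (s z, f z) A := ⟨_, hφ.hasMFDerivAt⟩
  have h1 : der E E'' (fun p => φ (s p, f p)) z = A.comp ((der E ℝ s z).prod (der E E' f z)) :=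
    (HasMFDerivAt.comp z hA (hs.hasMFDerivAt.prodMk hf.hasMFDerivAt)).mfderiv
  have h2 : der E' E'' (fun x => φ (s z, x)) (f z) =
      A.comp ((0 : E' →L[ℝ] ℝ).prod (ContinuousLinearMap.id ℝ E')) :=
    (HasMFDerivAt.comp (f z) hA
      ((hasMFDerivAt_const (s z) (f z)).prodMk (hasMFDerivAt_id (f z)))).mfderiv
  have h3 : der ℝ E'' (fun r => φ (r, f z)) (s z) =
      A.comp ((ContinuousLinearMap.id ℝ ℝ).prod (0 : ℝ →L[ℝ] E')) :=
    (HasMFDerivAt.comp (s z) hA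
      ((hasMFDerivAt_id (s z)).prodMk (hasMFDerivAt_const (f z) (s z)))).mfderiv
  rw [h1, h2, h3]
  simp only [ContinuousLinearMap.comp_apply, ContinuousLinearMap.prod_apply,
    ContinuousLinearMap.id_apply, zero_apply]
  rw [← map_add]
  simp

/-- `φ` is a smooth local flow, defined for times in `(-δ, δ)` and initial values in the open set
`V`, of the vector field `w`; it preserves the 2-form `β` and the function `H`. -/
structure IsLocalFlow (β : TwoForm E M) (H : M → ℝ) (w : M → E) (δ : ℝ) (V : Set M)
    (φ : ℝ × M → M) : Prop where
  isOpen : IsOpen V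
  smooth : ContMDiffOn (𝓘(ℝ, ℝ).prod 𝓘(ℝ, E)) 𝓘(ℝ, E) ∞ φ (Ioo (-δ) δ ×ˢ V)
  zero : ∀ x ∈ V, φ (0, x) = x
  velocity : ∀ x ∈ V, ∀ t ∈ Ioo (-δ) δ, HasMFDerivAt 𝓘(ℝ, ℝ) 𝓘(ℝ, E) (fun s => φ (s, x)) t
    (velocity (E := E) (w (φ (t, x))))
  form : ∀ x ∈ V, ∀ t ∈ Ioo (-δ) δ, ∀ u v : E, ev β (φ (t, x))
    (der E E (fun y => φ (t, y)) x u) (der E E (fun y => φ (t, y)) x v) = ev β x u v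
  hamiltonian : ∀ x ∈ V, ∀ t ∈ Ioo (-δ) δ, H (φ (t, x)) = H x

lemma IsLocalFlow.contMDiffAt {β : TwoForm E M} {H : M → ℝ} {w : M → E} {δ : ℝ} {V : Set M}
    {φ : ℝ × M → M} (h : IsLocalFlow β H w δ V φ) {t : ℝ} (ht : t ∈ Ioo (-δ) δ) {x : M}
    (hx : x ∈ V) : ContMDiffAt (𝓘(ℝ, ℝ).prod 𝓘(ℝ, E)) 𝓘(ℝ, E) ∞ φ (t, x) :=
  h.smooth.contMDiffAt ((isOpen_Ioo.prod h.isOpen).mem_nhds ⟨ht, hx⟩)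

lemma IsLocalFlow.contMDiffAt_slice {β : TwoForm E M} {H : M → ℝ} {w : M → E} {δ : ℝ}
    {V : Set M} {φ : ℝ × M → M} (h : IsLocalFlow β H w δ V φ) {t : ℝ} (ht : t ∈ Ioo (-δ) δ) {x : M}
    (hx : x ∈ V) : ContMDiffAt 𝓘(ℝ, E) 𝓘(ℝ, E) ∞ (fun y => φ (t, y)) x :=
  (h.contMDiffAt ht hx).comp x (contMDiffAt_const.prodMk contMDiffAt_id)

/-- A variation of the time moves the end point along the trajectory, so it contributes only a
multiple of `w`. -/
lemma IsLocalFlow.der_comp {β : TwoForm E M} {H : M → ℝ} {w : M → E} {δ : ℝ} {V : Set M}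
    {φ : ℝ × M → M} (h : IsLocalFlow β H w δ V φ) {s : M' → ℝ} {f : M' → M} {z : M'}
    (hs : MDifferentiableAt 𝓘(ℝ, E') 𝓘(ℝ, ℝ) s z)
    (hf : MDifferentiableAt 𝓘(ℝ, E') 𝓘(ℝ, E) f z) (hsz : s z ∈ Ioo (-δ) δ) (hfz : f z ∈ V)
    (u : E') :
    der E' E (fun p => φ (s p, f p)) z u =
      der E E (fun x => φ (s z, x)) (f z) (der E' E f z u) +
        der E' ℝ s z u • w (φ (s z, f z)) := by
  rw [der_comp_prod ((h.contMDiffAt hsz hfz).mdifferentiableAt (by simp)) hs hf u]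
  congr 1
  have : der ℝ E (fun r => φ (r, f z)) (s z) = SymplecticSection.velocity (w (φ (s z, f z))) :=
    (h.velocity (f z) hfz (s z) hsz).mfderiv
  rw [this, velocity_apply]

variable [IsManifold 𝓘(ℝ, E) ∞ M]

/-- Around every point, the Hamiltonian vector field has a smooth symplectic local flow. -/
theorem exists_isLocalFlow [FiniteDimensional ℝ E] {β : TwoForm E M} (hβ : IsSmoothForm β)
    (hcl : IsClosedForm β) (hnd : ∀ x u, (∀ v, ev β x u v = 0) → u = 0) {H : M → ℝ} {w : M → E}
    (hH : ContMDiff 𝓘(ℝ, E) 𝓘(ℝ, ℝ) ∞ H)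
    (hw : ∀ x u, ev β x (w x) u = - der E ℝ H x u) (q : M) :
    ∃ δ > 0, ∃ V φ, q ∈ V ∧ IsLocalFlow β H w δ V φ := by
  set χ := extChartAt 𝓘(ℝ, E) q with hχ
  have hΩ : IsOpen χ.target := isOpen_extChartAt_target q
  obtain ⟨δ, hδ, V, hV, hqV, ψ, hψ, hψ'⟩ := exists_smooth_local_flow hΩ
    (contDiffOn_fieldInChart hβ hnd hH hw q) (mem_extChartAt_target q)
  have hVopen : IsOpen (χ.source ∩ χ ⁻¹' V) :=
    (continuousOn_extChartAt q).isOpen_inter_preimage (isOpen_extChartAt_source q) hV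
  have hψat : ∀ t ∈ Ioo (-δ) δ, ∀ x ∈ V, ContDiffAt ℝ ∞ ψ (t, x) := fun t ht x hx =>
    hψ.contDiffAt ((isOpen_Ioo.prod hV).mem_nhds ⟨ht, hx⟩)
  have hψt : ∀ t ∈ Ioo (-δ) δ, ∀ x ∈ V, ContDiffAt ℝ ∞ (fun y => ψ (t, y)) x := fun t ht x hx =>
    (hψat t ht x hx).comp x (contDiffAt_const.prodMk contDiffAt_id)
  refine ⟨δ, hδ, χ.source ∩ χ ⁻¹' V, fun p => χ.symm (ψ (p.1, χ p.2)),
    ⟨mem_extChartAt_source q, hqV⟩, hVopen, ?_, ?_, ?_, ?_, ?_⟩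
  · rintro ⟨t, x⟩ ⟨ht, hx, hxV⟩
    refine ContMDiffAt.contMDiffWithinAt ?_
    have h1 : ContMDiffAt (𝓘(ℝ, ℝ).prod 𝓘(ℝ, E)) 𝓘(ℝ, ℝ × E) ∞
        (fun p : ℝ × M => (p.1, χ p.2)) (t, x) :=
      contMDiffAt_fst.prodMk_space (ContMDiffAt.comp (t, x) (contMDiffAt_chart hx) contMDiffAt_snd)
    exact ContMDiffAt.comp (t, x) (contMDiffAt_chart_symm ((hψ' _ hxV).2 t ht).1)
      (ContMDiffAt.comp (t, x) (hψat t ht _ hxV).contMDiffAt h1)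
  · rintro x ⟨hx, hxV⟩
    simp only
    rw [(hψ' _ hxV).1, χ.left_inv hx]
  · rintro x ⟨hx, hxV⟩ t ht
    obtain ⟨h1, h2⟩ := (hψ' _ hxV).2 t ht
    have h3 : HasMFDerivAt 𝓘(ℝ, ℝ) 𝓘(ℝ, E) (fun s => χ.symm (ψ (s, χ x))) t
        ((der E E χ.symm (ψ (t, χ x))).comp
          (SymplecticSection.velocity (E := E) (fieldInChart w q (ψ (t, χ x))))) :=
      HasMFDerivAt.comp t ((contMDiffAt_chart_symm h1).mdifferentiableAt (by simp)).hasMFDerivAt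
        (hasMFDerivAt_iff_hasFDerivAt.2 h2.hasFDerivAt)
    have h4 : (der E E χ.symm (ψ (t, χ x))).comp
        (SymplecticSection.velocity (E := E) (fieldInChart w q (ψ (t, χ x)))) =
        SymplecticSection.velocity (w (χ.symm (ψ (t, χ x)))) := by
      refine ContinuousLinearMap.ext fun r => ?_
      rw [ContinuousLinearMap.comp_apply, velocity_apply, velocity_apply, map_smul, fieldInChart,
        der_symm_der_chart' h1]
    exact HasMFDerivAt.congr_mfderiv h3 h4
  · rintro x ⟨hx, hxV⟩ t ht u v
    have h1 := ((hψ' _ hxV).2 t ht).1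
    have hd : der E E (fun y => χ.symm (ψ (t, χ y))) x =
        (der E E χ.symm (ψ (t, χ x))).comp
          ((fderiv ℝ (fun y => ψ (t, y)) (χ x)).comp (der E E χ x)) := by
      have hc : MDifferentiableAt 𝓘(ℝ, E) 𝓘(ℝ, E) χ x :=
        (contMDiffAt_chart hx).mdifferentiableAt (by simp)
      have hp : MDifferentiableAt 𝓘(ℝ, E) 𝓘(ℝ, E) (fun y => ψ (t, y)) (χ x) :=
        ((hψt t ht _ hxV).differentiableAt (by simp)).mdifferentiableAt
      have hs : MDifferentiableAt 𝓘(ℝ, E) 𝓘(ℝ, E) χ.symm (ψ (t, χ x)) :=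
        (contMDiffAt_chart_symm h1).mdifferentiableAt (by simp)
      rw [SymplecticSection.der_comp (f := fun y => ψ (t, χ y)) (g := χ.symm) hs
        (MDifferentiableAt.comp (g := fun y => ψ (t, y)) x hp hc),
        SymplecticSection.der_comp (f := χ) (g := fun y => ψ (t, y)) hp hc, der_eq_fderiv]
    have hpres := flow_preserves_form hΩ hV (hβ q) (contDiffOn_funInChart hH q) (hcl q)
      (fun y hy v => inChart_field hH hw hy v) hψ hψ' hxV ht (der E E χ x u) (der E E χ x v)
    have e1 : ∀ y a b, inChart β q y ![a, b] =
        ev β (χ.symm y) (der E E χ.symm y a) (der E E χ.symm y b) := fun y a b =>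
      ev_pullback (M := E) (E := E) χ.symm β y a b
    rw [e1, e1, der_symm_der_chart hx, der_symm_der_chart hx, χ.left_inv hx] at hpres
    simp only
    rw [hd]
    exact hpres
  · rintro x ⟨hx, hxV⟩ t ht
    have h := flow_preserves_hamiltonian (β := inChart β q) hΩ (contDiffOn_funInChart hH q)
      (fun y hy v => inChart_field hH hw hy v) (γ := fun s => ψ (s, χ x)) (hψ' _ hxV).2 ht
    simp only [(hψ' _ hxV).1, funInChart, ← hχ, χ.left_inv hx] at h
    exact h

/-- Integral curves on short intervals are given by the local flow. -/
lemma IsLocalFlow.eq_of_integralCurve [T2Space M] {β : TwoForm E M} {H : M → ℝ} {w : M → E}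
    {δ : ℝ} {V : Set M} {φ : ℝ × M → M} (h : IsLocalFlow β H w δ V φ)
    (hw : ∀ x₀ : M, ContDiffOn ℝ ∞ (fieldInChart w x₀) (extChartAt 𝓘(ℝ, E) x₀).target)
    {η : ℝ → M} {a b : ℝ} (hab : a ≤ b) (hδ : b - a < δ)
    (hη : ∀ t ∈ Icc a b, HasMFDerivWithinAt 𝓘(ℝ, ℝ) 𝓘(ℝ, E) η (Icc a b) t
      (SymplecticSection.velocity (E := E) (w (η t)))) (ha : η a ∈ V) :
    η b = φ (b - a, η a) := by
  refine integralCurve_unique (ζ := fun t => φ (t - a, η a)) hw hη (fun t ht => ?_) ?_ b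
    (right_mem_Icc.2 hab)
  · have h1 := h.velocity _ ha (t - a) ⟨by linarith [ht.1], by linarith [ht.2]⟩
    have h2 : HasMFDerivAt 𝓘(ℝ, ℝ) 𝓘(ℝ, ℝ) (fun t : ℝ => t - a) t (ContinuousLinearMap.id ℝ ℝ) :=
      hasMFDerivAt_iff_hasFDerivAt.2 ((hasFDerivAt_id t).sub_const a)
    exact (HasMFDerivAt.comp t h1 h2).hasMFDerivWithinAt
  · simp only [sub_self]
    exact (h.zero _ ha).symm

end LocalFlow

/-! ### Composition of local flows along a trajectory. -/

section Transport

open Set Filter Topology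

variable {E : Type*} [NormedAddCommGroup E] [NormedSpace ℝ E]
  {M : Type*} [TopologicalSpace M] [ChartedSpace E M]

/-- `F` is a smooth map on the open set `U`, preserving the 2-form `β` and the function `H`, which
sends the initial point of any integral curve of `w` on an interval `[0, t']` with `t ≤ t'` to its
point at the time `t`. -/
structure IsTransport (β : TwoForm E M) (H : M → ℝ) (w : M → E) (t : ℝ) (U : Set M)
    (F : M → M) : Prop where
  isOpen : IsOpen U
  smooth : ContMDiffOn 𝓘(ℝ, E) 𝓘(ℝ, E) ∞ F U
  form : ∀ x ∈ U, ∀ u v : E, ev β (F x) (der E E F x u) (der E E F x v) = ev β x u v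
  hamiltonian : ∀ x ∈ U, H (F x) = H x
  trajectory : ∀ (η : ℝ → M) (t' : ℝ), t ≤ t' → η 0 ∈ U →
    (∀ r ∈ Icc 0 t', HasMFDerivWithinAt 𝓘(ℝ, ℝ) 𝓘(ℝ, E) η (Icc 0 t') r
      (velocity (E := E) (w (η r)))) → η t = F (η 0)

lemma IsTransport.contMDiffAt {β : TwoForm E M} {H : M → ℝ} {w : M → E} {t : ℝ} {U : Set M}
    {F : M → M} (h : IsTransport β H w t U F) {x : M} (hx : x ∈ U) :
    ContMDiffAt 𝓘(ℝ, E) 𝓘(ℝ, E) ∞ F x :=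
  h.smooth.contMDiffAt (h.isOpen.mem_nhds hx)

lemma isTransport_id (β : TwoForm E M) (H : M → ℝ) (w : M → E) :
    IsTransport β H w 0 univ (fun x => x) where
  isOpen := isOpen_univ
  smooth := contMDiff_id.contMDiffOn
  form x _ u v := by rw [der_id]; rfl
  hamiltonian _ _ := rfl
  trajectory _ _ _ _ _ := rfl

variable [IsManifold 𝓘(ℝ, E) ∞ M] [T2Space M]

/-- Since `F (η 0) = η t₁`, the remaining piece of the curve starts in `V` and is shorter than `δ`,
where the local flow describes it. -/
lemma IsTransport.step {β : TwoForm E M} {H : M → ℝ} {w : M → E}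
    (hw : ∀ x₀ : M, ContDiffOn ℝ ∞ (fieldInChart w x₀) (extChartAt 𝓘(ℝ, E) x₀).target)
    {t₁ t₂ δ : ℝ} {U V : Set M} {F : M → M} {φ : ℝ × M → M} (hF : IsTransport β H w t₁ U F)
    (hφ : IsLocalFlow β H w δ V φ) (h0 : 0 ≤ t₁) (h12 : t₁ ≤ t₂) (hδ : t₂ - t₁ < δ) :
    IsTransport β H w t₂ (U ∩ F ⁻¹' V) (fun x => φ (t₂ - t₁, F x)) := by
  have ht : t₂ - t₁ ∈ Ioo (-δ) δ := ⟨by linarith, hδ⟩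
  refine ⟨hF.smooth.continuousOn.isOpen_inter_preimage hF.isOpen hφ.isOpen, ?_, ?_, ?_, ?_⟩
  · rintro x ⟨hxU, hxV⟩
    exact (ContMDiffAt.comp x (hφ.contMDiffAt_slice ht hxV) (hF.contMDiffAt hxU)).contMDiffWithinAt
  · rintro x ⟨hxU, hxV⟩ u v
    have hd : der E E (fun y => φ (t₂ - t₁, F y)) x =
        (der E E (fun y => φ (t₂ - t₁, y)) (F x)).comp (der E E F x) :=
      der_comp (g := fun y => φ (t₂ - t₁, y))
        ((hφ.contMDiffAt_slice ht hxV).mdifferentiableAt (by simp))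
        ((hF.contMDiffAt hxU).mdifferentiableAt (by simp))
    rw [hd]
    exact (hφ.form _ hxV _ ht _ _).trans (hF.form x hxU u v)
  · rintro x ⟨hxU, hxV⟩
    exact (hφ.hamiltonian _ hxV _ ht).trans (hF.hamiltonian x hxU)
  · rintro η t' ht' ⟨hηU, hηV⟩ hη
    have h1 := hF.trajectory η t' (h12.trans ht') hηU hη
    have hsub : Icc t₁ t₂ ⊆ Icc 0 t' := Icc_subset_Icc h0 ht'
    rw [← h1]
    refine hφ.eq_of_integralCurve hw h12 hδ (fun r hr => (hη r (hsub hr)).mono hsub) ?_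
    rw [h1]
    exact hηV

/-- The transport along a given integral curve exists near its initial point. -/
theorem exists_isTransport {β : TwoForm E M} {H : M → ℝ} {w : M → E}
    (hw : ∀ x₀ : M, ContDiffOn ℝ ∞ (fieldInChart w x₀) (extChartAt 𝓘(ℝ, E) x₀).target)
    (hflow : ∀ q : M, ∃ δ > 0, ∃ V φ, q ∈ V ∧ IsLocalFlow β H w δ V φ)
    {γ : ℝ → M} {T : ℝ} (hT : 0 ≤ T)
    (hγ : ∀ r ∈ Icc 0 T, HasMFDerivWithinAt 𝓘(ℝ, ℝ) 𝓘(ℝ, E) γ (Icc 0 T) r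
      (velocity (E := E) (w (γ r)))) :
    ∃ U F, γ 0 ∈ U ∧ IsTransport β H w T U F := by
  choose δ hδ V φ hV hφ using hflow
  have hγc : Continuous (fun r : Icc 0 T => γ r) :=
    continuousOn_iff_continuous_domRestrict.1 fun r hr => (hγ r hr).1
  -- Two times in one set `c s` differ by less than `δ (γ s)`, since each is within half of it from
  -- `s`; so one local flow covers each piece of a fine subdivision.
  let c : Icc 0 T → Set (Icc 0 T) := fun s =>
    {r | γ r ∈ V (γ s)} ∩ {r | |(r : ℝ) - s| < δ (γ s) / 2}
  have hc : ∀ s, IsOpen (c s) := fun s =>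
    ((hφ (γ s)).isOpen.preimage hγc).inter
      (isOpen_lt (by fun_prop) continuous_const)
  obtain ⟨t, ht0, htm, ⟨n, hn⟩, htc⟩ := exists_monotone_Icc_subset_open_cover_Icc hT hc
    (fun s _ => mem_iUnion.2 ⟨s, hV _, by simpa using hδ (γ s)⟩)
  have hind : ∀ k, ∃ U F, γ 0 ∈ U ∧ IsTransport β H w (t k) U F := by
    intro k
    induction k with
    | zero => rw [ht0]; exact ⟨univ, _, mem_univ _, isTransport_id β H w⟩
    | succ k ih =>
      obtain ⟨U, F, hU, hF⟩ := ih
      obtain ⟨s, hs⟩ := htc k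
      have hle : t k ≤ t (k + 1) := htm k.le_succ
      have h1 := hs (left_mem_Icc.2 hle)
      have h2 := hs (right_mem_Icc.2 hle)
      have hlt : (t (k + 1) : ℝ) - t k < δ (γ s) := by
        have h3 : |(t k : ℝ) - s| < δ (γ s) / 2 := h1.2
        have h4 : |(t (k + 1) : ℝ) - s| < δ (γ s) / 2 := h2.2
        linarith [(abs_lt.1 h3).1, (abs_lt.1 h4).2]
      refine ⟨U ∩ F ⁻¹' V (γ s), fun x => φ (γ s) (t (k + 1) - t k, F x), ⟨hU, ?_⟩,
        hF.step hw (hφ (γ s)) (t k).2.1 hle hlt⟩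
      -- The transport sends `γ 0` to `γ (t k)`, which lies in the domain of the next local flow.
      have := hF.trajectory γ T (t k).2.2 hU hγ
      rw [mem_preimage, ← this]
      exact h1.1
  have := hind n
  rwa [hn n le_rfl] at this

end Transport

/-! ### Immersions and functions vanishing along them. -/

section Immersion

open Set Filter Topology Manifold

variable {E : Type*} [NormedAddCommGroup E] [NormedSpace ℝ E]
  {M : Type*} [TopologicalSpace M] [ChartedSpace E M]
  {E₁ : Type*} [NormedAddCommGroup E₁] [NormedSpace ℝ E₁]
  {P : Type*} [TopologicalSpace P] [ChartedSpace E₁ P]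

/-- The derivative of a chart is invertible. -/
lemma exists_inverse_der_extend {e : OpenPartialHomeomorph M E}
    (he : e ∈ IsManifold.maximalAtlas 𝓘(ℝ, E) ∞ M) {x : M} (hx : x ∈ e.source) :
    ∃ B : E →L[ℝ] E, (∀ u, B (der E E (e.extend 𝓘(ℝ, E)) x u) = u) ∧
      ∀ u, der E E (e.extend 𝓘(ℝ, E)) x (B u) = u := by
  set κ := e.extend 𝓘(ℝ, E) with hκ
  have hsrc : κ.source = e.source := e.extend_source
  have hxs : x ∈ κ.source := hsrc ▸ hx
  have htar : IsOpen κ.target := e.isOpen_extend_target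
  have h1 : MDifferentiableAt 𝓘(ℝ, E) 𝓘(ℝ, E) κ x :=
    (OpenPartialHomeomorph.contMDiffAt_extend he hx).mdifferentiableAt (by simp)
  have h2 : MDifferentiableAt 𝓘(ℝ, E) 𝓘(ℝ, E) κ.symm (κ x) := by
    have h := contMDiffOn_extend_symm he
    rw [← e.extend_target'] at h
    exact (h.contMDiffAt (htar.mem_nhds (κ.map_source hxs))).mdifferentiableAt (by simp)
  refine ⟨der E E κ.symm (κ x), fun u => ?_, fun u => ?_⟩
  · have h := der_comp h2 h1
    have h3 : (fun y => κ.symm (κ y)) =ᶠ[𝓝 x] fun y => y := by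
      filter_upwards [e.open_source.mem_nhds hx] with y hy using κ.left_inv (hsrc ▸ hy)
    rw [der_congr h3, der_id] at h
    exact (congrArg (fun A : E →L[ℝ] E => A u) h).symm
  · rw [← κ.left_inv hxs] at h1
    have h := der_comp h1 h2
    have h3 : (fun y => κ (κ.symm y)) =ᶠ[𝓝 (κ x)] fun y => y := by
      filter_upwards [htar.mem_nhds (κ.map_source hxs)] with y hy using κ.right_inv hy
    rw [der_congr h3, der_id, κ.left_inv hxs] at h
    exact (congrArg (fun A : E →L[ℝ] E => A u) h).symm

/-- The differential of an immersion is injective, and any vector outside of its image is detected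
by a function vanishing along the immersion. -/
lemma injective_der_and_exists_function {ι : P → M} {x : P}
    (hι : IsImmersionAt 𝓘(ℝ, E₁) 𝓘(ℝ, E) ∞ ι x) :
    Function.Injective (der E₁ E ι x) ∧ ∀ v, v ∉ range (der E₁ E ι x) →
      ∃ g : M → ℝ, ContMDiffAt 𝓘(ℝ, E) 𝓘(ℝ, ℝ) ∞ g (ι x) ∧ der E ℝ g (ι x) v ≠ 0 ∧
        ∀ᶠ y in 𝓝 x, g (ι y) = 0 := by
  set κ := hι.codChart.extend 𝓘(ℝ, E) with hκ
  set d := hι.domChart.extend 𝓘(ℝ, E₁) with hd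
  obtain ⟨B, hB, -⟩ := exists_inverse_der_extend hι.codChart_mem_maximalAtlas
    hι.mem_codChart_source
  obtain ⟨C, hC, hC'⟩ := exists_inverse_der_extend hι.domChart_mem_maximalAtlas
    hι.mem_domChart_source
  rw [← hκ] at hB
  rw [← hd] at hC hC'
  have hκs : ContMDiffAt 𝓘(ℝ, E) 𝓘(ℝ, E) ∞ κ (ι x) :=
    OpenPartialHomeomorph.contMDiffAt_extend hι.codChart_mem_maximalAtlas hι.mem_codChart_source
  have hds : ContMDiffAt 𝓘(ℝ, E₁) 𝓘(ℝ, E₁) ∞ d x :=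
    OpenPartialHomeomorph.contMDiffAt_extend hι.domChart_mem_maximalAtlas hι.mem_domChart_source
  let L : E₁ →L[ℝ] E :=
    (hι.equiv : (E₁ × hι.complement) →L[ℝ] E).comp (ContinuousLinearMap.inl ℝ E₁ hι.complement)
  -- In the immersion charts the map is the linear inclusion `u ↦ (u, 0)`, so its derivative can be
  -- read off.
  have hnear : (fun y => κ (ι y)) =ᶠ[𝓝 x] fun y => L (d y) := by
    filter_upwards [hι.domChart.open_source.mem_nhds hι.mem_domChart_source] with y hy
    have hy' : y ∈ d.source := by rwa [hd, OpenPartialHomeomorph.extend_source]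
    have h := hι.writtenInCharts (d.map_source hy')
    simp only [Function.comp_apply, ← hd, d.left_inv hy'] at h
    exact h
  have hder : ∀ u, der E E κ (ι x) (der E₁ E ι x u) = hι.equiv (der E₁ E₁ d x u, 0) := by
    intro u
    have h1 := der_comp (hκs.mdifferentiableAt (by simp))
      (hι.contMDiffAt.mdifferentiableAt (by simp))
    have hL : MDifferentiableAt 𝓘(ℝ, E₁) 𝓘(ℝ, E) L (d x) := L.differentiableAt.mdifferentiableAt
    have h2 := der_comp (g := L) hL (hds.mdifferentiableAt (by simp))
    rw [der_congr hnear, h2, der_eq_fderiv, L.fderiv] at h1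
    exact (congrArg (fun A : E₁ →L[ℝ] E => A u) h1).symm
  refine ⟨(injective_iff_map_eq_zero _).2 fun u hu => ?_, fun v hv => ?_⟩
  · have h := hder u
    rw [hu, map_zero, eq_comm, map_eq_zero_iff _ hι.equiv.injective] at h
    rw [← hC u, show der E₁ E₁ d x u = 0 from congrArg Prod.fst h, map_zero]
  -- A vector outside the image has a nonzero component in the complement. A functional detecting
  -- this component, composed with the chart, vanishes along the immersion.
  · let R : E →L[ℝ] hι.complement := (ContinuousLinearMap.snd ℝ E₁ hι.complement).comp
      (hι.equiv.symm : E →L[ℝ] (E₁ × hι.complement))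
    have hR : R (der E E κ (ι x) v) ≠ 0 := by
      intro h0
      refine hv ⟨C (hι.equiv.symm (der E E κ (ι x) v)).1, ?_⟩
      have h1 : der E E κ (ι x) (der E₁ E ι x (C (hι.equiv.symm (der E E κ (ι x) v)).1)) =
          der E E κ (ι x) v := by
        rw [hder, hC', ← ContinuousLinearEquiv.eq_symm_apply]
        exact Prod.ext rfl h0.symm
      rw [← hB (der E₁ E ι x _), h1, hB]
    obtain ⟨l, hl⟩ := SeparatingDual.exists_ne_zero (R := ℝ) hR
    let A : E →L[ℝ] ℝ := l.comp R
    refine ⟨fun y => A (κ y), ContMDiffAt.comp (ι x) A.contMDiff.contMDiffAt hκs, ?_, ?_⟩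
    · have hA : MDifferentiableAt 𝓘(ℝ, E) 𝓘(ℝ, ℝ) A (κ (ι x)) :=
        A.differentiableAt.mdifferentiableAt
      have h2 := der_comp (g := A) hA (hκs.mdifferentiableAt (by simp))
      rw [h2, der_eq_fderiv, A.fderiv]
      exact hl
    · filter_upwards [hnear] with y hy
      rw [hy]
      simp [A, R, L]

end Immersion

/-! ### Pullbacks of symplectic forms to transverse sections. -/

section Restriction

open Set Filter Topology Manifold

variable {E : Type*} [NormedAddCommGroup E] [NormedSpace ℝ E]
  {M : Type*} [TopologicalSpace M] [ChartedSpace E M]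
  {E₁ : Type*} [NormedAddCommGroup E₁] [NormedSpace ℝ E₁]
  {P : Type*} [TopologicalSpace P] [ChartedSpace E₁ P]

/-- Restricting a nondegenerate alternating form `B` to the range of `A`, a complement of `w` in the
kernel of `B(w, ·)`, gives a nondegenerate form. -/
lemma nondegenerate_of_transverse [FiniteDimensional ℝ E] [FiniteDimensional ℝ E₁]
    (hdim : Module.finrank ℝ E₁ + 2 = Module.finrank ℝ E) (η : TwoForm E M) (x : M)
    (hnd : ∀ u, (∀ v, ev η x u v = 0) → u = 0) {α : E →L[ℝ] ℝ} {w : E}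
    (hw : ∀ v, ev η x w v = - α v) {A : E₁ →L[ℝ] E} (hA : Function.Injective A)
    (hwA : w ∉ range A) (hαA : ∀ u, α (A u) = 0) {u : E₁}
    (hu : ∀ v, ev η x (A u) (A v) = 0) : u = 0 := by
  have hw0 : w ≠ 0 := fun h => hwA ⟨0, by rw [h, map_zero]⟩
  have hαw : α w = 0 := by linarith [hw w, ev_self η x w]
  obtain ⟨z, hz⟩ : ∃ z, α z ≠ 0 := by
    by_contra! h
    exact hw0 (hnd w fun v => by rw [hw, h, neg_zero])
  -- `range A ⊕ ℝw` lies in `ker α` and has the same dimension, `dim E - 1`.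
  have hker : ∀ v, α v = 0 → ∃ a, ∃ c : ℝ, v = A a + c • w := by
    let T : E₁ × ℝ →ₗ[ℝ] LinearMap.ker (α : E →ₗ[ℝ] ℝ) :=
      LinearMap.codRestrict _ ((A : E₁ →ₗ[ℝ] E).coprod (LinearMap.toSpanSingleton ℝ E w))
        fun p => by simp [hαA, hαw]
    have hT : ∀ p, (T p : E) = A p.1 + p.2 • w := fun p => by simp [T]
    have hinj : Function.Injective T := by
      refine (injective_iff_map_eq_zero _).2 fun p hp => ?_
      have h1 : A p.1 + p.2 • w = 0 := by rw [← hT, hp]; rfl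
      have h2 : p.2 = 0 := by
        by_contra h2
        refine hwA ⟨-(p.2⁻¹ • p.1), ?_⟩
        rw [map_neg, map_smul, eq_neg_of_add_eq_zero_left h1, smul_neg, neg_neg, smul_smul,
          inv_mul_cancel₀ h2, one_smul]
      rw [h2, zero_smul, add_zero] at h1
      exact Prod.ext ((injective_iff_map_eq_zero _).1 hA _ h1) h2
    have hrank := Module.Dual.finrank_ker_add_one_of_ne_zero (f := (α : E →ₗ[ℝ] ℝ))
      (fun h => hz (LinearMap.congr_fun h z))
    have hfin : Module.finrank ℝ (E₁ × ℝ) = Module.finrank ℝ (LinearMap.ker (α : E →ₗ[ℝ] ℝ)) := by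
      rw [Module.finrank_prod, Module.finrank_self]
      omega
    have hsurj := (LinearMap.injective_iff_surjective_of_finrank_eq_finrank hfin).1 hinj
    intro v hv
    obtain ⟨p, hp⟩ := hsurj ⟨v, hv⟩
    exact ⟨p.1, p.2, by rw [← hT, hp]⟩
  have hvan : ∀ v, α v = 0 → ev η x (A u) v = 0 := by
    intro v hv
    obtain ⟨a, c, rfl⟩ := hker v hv
    rw [ev_add_right, hu, ev_smul_right, ev_swap, hw, hαA]
    ring
  -- The functional `η(A u, ·)` vanishes on `ker α`, so it equals `c α = -c η(w, ·)`. Hence `A u + c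
  -- w = 0` by nondegeneracy, and transversality forces `c = 0`.
  set c := ev η x (A u) z / α z with hc
  have h0 : A u + c • w = 0 := by
    refine hnd _ fun v => ?_
    have h1 : v = (v - (α v / α z) • z) + (α v / α z) • z := by abel
    have h2 : ev η x (A u) v = α v / α z * ev η x (A u) z := by
      conv_lhs => rw [h1]
      rw [ev_add_right, ev_smul_right, hvan, zero_add]
      rw [map_sub, map_smul, smul_eq_mul, div_mul_cancel₀ _ hz, sub_self]
    rw [ev_add_left, ev_smul_left, hw, h2, hc]
    ring
  have hc0 : c = 0 := by
    by_contra h2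
    refine hwA ⟨-(c⁻¹ • u), ?_⟩
    rw [map_neg, map_smul, eq_neg_of_add_eq_zero_left h0, smul_neg, neg_neg, smul_smul,
      inv_mul_cancel₀ h2, one_smul]
  rw [hc0, zero_smul, add_zero] at h0
  exact (injective_iff_map_eq_zero _).1 hA _ h0

variable [IsManifold 𝓘(ℝ, E) ∞ M] [IsManifold 𝓘(ℝ, E₁) ∞ P]

/-- The coordinate expression of a pullback. -/
lemma inChart_pullback {ι : P → M} (hι : ContMDiff 𝓘(ℝ, E₁) 𝓘(ℝ, E) ∞ ι) (β : TwoForm E M)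
    (y₀ : P) {y : E₁} (hy : y ∈ (extChartAt 𝓘(ℝ, E₁) y₀).target) :
    ∃ x₁ : M, ∃ f : E₁ → E, ContDiffAt ℝ ∞ f y ∧ f y ∈ (extChartAt 𝓘(ℝ, E) x₁).target ∧
      inChart (pullback ι β) y₀ =ᶠ[𝓝 y]
        fun y' => (inChart β x₁ (f y')).compContinuousLinearMap (fderiv ℝ f y') := by
  set ψ := extChartAt 𝓘(ℝ, E₁) y₀ with hψ
  set x₁ := ι (ψ.symm y) with hx₁
  set χ := extChartAt 𝓘(ℝ, E) x₁ with hχ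
  have hψs : ∀ y' ∈ ψ.target, ContMDiffAt 𝓘(ℝ, E₁) 𝓘(ℝ, E₁) ∞ ψ.symm y' := fun y' hy' =>
    contMDiffAt_chart_symm hy'
  have hc : ∀ y' ∈ ψ.target, ContMDiffAt 𝓘(ℝ, E₁) 𝓘(ℝ, E) ∞ (fun z => ι (ψ.symm z)) y' :=
    fun y' hy' => ContMDiffAt.comp y' hι.contMDiffAt (hψs y' hy')
  have hsm : ∀ y' ∈ ψ.target, ι (ψ.symm y') ∈ χ.source →
      ContMDiffAt 𝓘(ℝ, E₁) 𝓘(ℝ, E) ∞ (fun z => χ (ι (ψ.symm z))) y' := fun y' hy' hs =>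
    ContMDiffAt.comp y' (contMDiffAt_chart hs) (hc y' hy')
  have hys : ι (ψ.symm y) ∈ χ.source := mem_extChartAt_source x₁
  refine ⟨x₁, fun z => χ (ι (ψ.symm z)), (hsm y hy hys).contDiffAt, χ.map_source hys, ?_⟩
  filter_upwards [(isOpen_extChartAt_target y₀).mem_nhds hy,
    (hc y hy).continuousAt.preimage_mem_nhds ((isOpen_extChartAt_source x₁).mem_nhds hys)]
    with y' hy' hs
  refine alternating_ext fun a b => ?_
  have e1 : inChart (pullback ι β) y₀ y' ![a, b] = ev β (ι (ψ.symm y'))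
      (der E₁ E ι (ψ.symm y') (der E₁ E₁ ψ.symm y' a))
      (der E₁ E ι (ψ.symm y') (der E₁ E₁ ψ.symm y' b)) := by
    rw [← ev_pullback]
    exact ev_pullback (M := E₁) (E := E₁) ψ.symm (pullback ι β) y' a b
  have hd : ∀ u, fderiv ℝ (fun z => χ (ι (ψ.symm z))) y' u =
      der E E χ (ι (ψ.symm y')) (der E₁ E ι (ψ.symm y') (der E₁ E₁ ψ.symm y' u)) := by
    intro u
    rw [← der_eq_fderiv, der_comp (g := χ) (f := fun z => ι (ψ.symm z))
      ((contMDiffAt_chart hs).mdifferentiableAt (by simp))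
      ((hc y' hy').mdifferentiableAt (by simp)),
      der_comp (g := ι) (f := ψ.symm) (hι.mdifferentiableAt (by simp))
      ((hψs y' hy').mdifferentiableAt (by simp))]
    rfl
  have e2 : ∀ u v, inChart β x₁ (χ (ι (ψ.symm y'))) ![u, v] = ev β (ι (ψ.symm y'))
      (der E E χ.symm (χ (ι (ψ.symm y'))) u) (der E E χ.symm (χ (ι (ψ.symm y'))) v) := by
    intro u v
    have h := ev_pullback (M := E) (E := E) χ.symm β (χ (ι (ψ.symm y'))) u v
    rwa [χ.left_inv hs] at h
  have e3 : ((inChart β x₁ (χ (ι (ψ.symm y')))).compContinuousLinearMap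
      (fderiv ℝ (fun z => χ (ι (ψ.symm z))) y')) ![a, b] =
      inChart β x₁ (χ (ι (ψ.symm y'))) ![fderiv ℝ (fun z => χ (ι (ψ.symm z))) y' a,
        fderiv ℝ (fun z => χ (ι (ψ.symm z))) y' b] := by
    rw [ContinuousAlternatingMap.compContinuousLinearMap_apply]
    congr 1
    ext i; fin_cases i <;> rfl
  rw [e1, e3, e2, hd, hd, der_symm_der_chart hs, der_symm_der_chart hs]

lemma isSmoothForm_pullback {ι : P → M} (hι : ContMDiff 𝓘(ℝ, E₁) 𝓘(ℝ, E) ∞ ι) {β : TwoForm E M}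
    (hβ : IsSmoothForm β) : IsSmoothForm (pullback (E := E₁) ι β) := by
  intro y₀ y hy
  obtain ⟨x₁, f, hf, hfy, h⟩ := inChart_pullback hι β y₀ hy
  have h1 := (hβ x₁).contDiffAt ((isOpen_extChartAt_target x₁).mem_nhds hfy)
  exact ((contDiffAt_compContinuousLinearMap (h1.comp y hf)
    (hf.fderiv_right (by simp))).congr_of_eventuallyEq h).contDiffWithinAt

/-- The exterior derivative depends only on the germ and commutes with pullback between vector
spaces, to which `inChart_pullback` reduces the claim. -/
lemma isClosedForm_pullback {ι : P → M} (hι : ContMDiff 𝓘(ℝ, E₁) 𝓘(ℝ, E) ∞ ι) {β : TwoForm E M}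
    (hβ : IsSmoothForm β) (hcl : IsClosedForm β) : IsClosedForm (pullback (E := E₁) ι β) := by
  intro y₀ y hy
  obtain ⟨x₁, f, hf, hfy, h⟩ := inChart_pullback hι β y₀ hy
  have h1 := (hβ x₁).contDiffAt ((isOpen_extChartAt_target x₁).mem_nhds hfy)
  rw [h.extDeriv_eq, extDeriv_pullback (r := ∞) (h1.differentiableAt (by simp)) hf
    (by simp only [minSmoothness_of_isRCLikeNormedField]; exact two_le_infty), hcl x₁ _ hfy]
  rfl

end Restriction

/-! ### Smoothness of the transit time and symplecticity of the hitting map. -/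

section Hitting

open Set Filter Topology Manifold

/-- A continuous solution of a regular equation `k (y, σ y) = 0` is smooth. -/
lemma contDiffAt_of_implicit {E₁ : Type*} [NormedAddCommGroup E₁] [NormedSpace ℝ E₁]
    [CompleteSpace E₁] {k : E₁ × ℝ → ℝ} {σ : E₁ → ℝ} {y : E₁}
    (hk : ContDiffAt ℝ ∞ k (y, σ y)) (hσ : ContinuousAt σ y) (h0 : ∀ᶠ z in 𝓝 y, k (z, σ z) = 0)
    (hd : fderiv ℝ k (y, σ y) (0, 1) ≠ 0) : ContDiffAt ℝ ∞ σ y := by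
  have hinv : (fderiv ℝ k (y, σ y) ∘L .inr ℝ E₁ ℝ).IsInvertible := by
    refine ⟨ContinuousLinearEquiv.unitsEquivAut ℝ (Units.mk0 _ hd), ?_⟩
    ext
    simp
  refine (hk.contDiffAt_implicitFunction (by simp) hinv).congr_of_eventuallyEq ?_
  -- Continuity of `σ` keeps its graph in the neighbourhood where the implicit function is the only
  -- solution.
  have h1 : Tendsto (fun z => (z, σ z)) (𝓝 y) (𝓝 (y, σ y)) := continuousAt_id.prodMk hσ
  filter_upwards [h1.eventually (hk.eventually_apply_eq_iff_implicitFunction (by simp) hinv), h0]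
    with z hz hz0
  exact (hz.1 (by rw [hz0, h0.self_of_nhds])).symm

variable {E : Type*} [NormedAddCommGroup E] [NormedSpace ℝ E]
  {M : Type*} [TopologicalSpace M] [ChartedSpace E M]
  {E₁ : Type*} [NormedAddCommGroup E₁] [NormedSpace ℝ E₁]
  {P : Type*} [TopologicalSpace P] [ChartedSpace E₁ P] [IsManifold 𝓘(ℝ, E₁) ∞ P]
  {E₂ : Type*} [NormedAddCommGroup E₂] [NormedSpace ℝ E₂]
  {P₂ : Type*} [TopologicalSpace P₂] [ChartedSpace E₂ P₂]

/-- A continuous transit time to a hypersurface transverse to the flow is smooth. -/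
lemma IsLocalFlow.contMDiffAt_transit_time [CompleteSpace E₁] {β : TwoForm E M} {H : M → ℝ}
    {w : M → E} {δ : ℝ} {V : Set M} {φ : ℝ × M → M} (h : IsLocalFlow β H w δ V φ) {s : P → ℝ}
    {f : P → M} {z : P} (hs : ContinuousAt s z) (hf : ContMDiffAt 𝓘(ℝ, E₁) 𝓘(ℝ, E) ∞ f z)
    (hsz : s z ∈ Ioo (-δ) δ) (hfz : f z ∈ V) {g : M → ℝ}
    (hg : ContMDiffAt 𝓘(ℝ, E) 𝓘(ℝ, ℝ) ∞ g (φ (s z, f z)))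
    (hgw : der E ℝ g (φ (s z, f z)) (w (φ (s z, f z))) ≠ 0)
    (h0 : ∀ᶠ y in 𝓝 z, g (φ (s y, f y)) = 0) : ContMDiffAt 𝓘(ℝ, E₁) 𝓘(ℝ, ℝ) ∞ s z := by
  set ψ := extChartAt 𝓘(ℝ, E₁) z with hψ
  have hzs : z ∈ ψ.source := mem_extChartAt_source z
  have hzt : ψ z ∈ ψ.target := mem_extChartAt_target z
  have hinv : ψ.symm (ψ z) = z := ψ.left_inv hzs
  have hψs : ContMDiffAt 𝓘(ℝ, E₁) 𝓘(ℝ, E₁) ∞ ψ.symm (ψ z) := contMDiffAt_chart_symm hzt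
  have hψt : Tendsto ψ.symm (𝓝 (ψ z)) (𝓝 z) := by
    have := hψs.continuousAt
    rwa [ContinuousAt, hinv] at this
  -- The equation `k = 0` is regular in the time variable: its time derivative is `dg(w) ≠ 0`.
  let k : E₁ × ℝ → ℝ := fun p => g (φ (p.2, f (ψ.symm p.1)))
  let σ : E₁ → ℝ := fun y => s (ψ.symm y)
  have hσz : σ (ψ z) = s z := by simp only [σ, hinv]
  have hσ : ContinuousAt σ (ψ z) := by
    rw [ContinuousAt, hσz]
    exact hs.tendsto.comp hψt
  have hf' : ContMDiffAt 𝓘(ℝ, E₁ × ℝ) 𝓘(ℝ, E) ∞ (fun p : E₁ × ℝ => f (ψ.symm p.1))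
      (ψ z, s z) := by
    rw [← hinv] at hf
    exact ContMDiffAt.comp (g := fun y => f (ψ.symm y)) (f := Prod.fst) (ψ z, s z)
      (hf.comp (ψ z) hψs) (contDiff_fst.contMDiff.contMDiffAt)
  have hk : ContDiffAt ℝ ∞ k (ψ z, σ (ψ z)) := by
    rw [hσz]
    have h1 : ContMDiffAt 𝓘(ℝ, E₁ × ℝ) (𝓘(ℝ, ℝ).prod 𝓘(ℝ, E)) ∞
        (fun p : E₁ × ℝ => (p.2, f (ψ.symm p.1))) (ψ z, s z) :=
      contDiff_snd.contMDiff.contMDiffAt.prodMk hf'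
    have h2 : ContMDiffAt 𝓘(ℝ, E₁ × ℝ) 𝓘(ℝ, E) ∞
        (fun p : E₁ × ℝ => φ (p.2, f (ψ.symm p.1))) (ψ z, s z) := by
      refine ContMDiffAt.comp (ψ z, s z) ?_ h1
      simp only [hinv]
      exact h.contMDiffAt hsz hfz
    have h3 : ContMDiffAt 𝓘(ℝ, E₁ × ℝ) 𝓘(ℝ, ℝ) ∞ k (ψ z, s z) := by
      refine ContMDiffAt.comp (ψ z, s z) ?_ h2
      simp only [hinv]
      exact hg
    exact h3.contDiffAt
  have hk0 : ∀ᶠ y in 𝓝 (ψ z), k (y, σ y) = 0 := hψt.eventually h0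
  have hkd : fderiv ℝ k (ψ z, σ (ψ z)) (0, 1) ≠ 0 := by
    have h1 : HasFDerivAt (fun r : ℝ => k (ψ z, r))
        ((fderiv ℝ k (ψ z, σ (ψ z))).comp (ContinuousLinearMap.inr ℝ E₁ ℝ)) (σ (ψ z)) :=
      (hk.differentiableAt (by simp)).hasFDerivAt.comp (σ (ψ z)) (hasFDerivAt_prodMk_right _ _)
    have h2 : der ℝ ℝ (fun r : ℝ => g (φ (r, f z))) (s z) =
        (der E ℝ g (φ (s z, f z))).comp (SymplecticSection.velocity (w (φ (s z, f z)))) :=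
      (HasMFDerivAt.comp (s z) (hg.mdifferentiableAt (by simp)).hasMFDerivAt
        (h.velocity (f z) hfz (s z) hsz)).mfderiv
    have h3 : (fun r : ℝ => k (ψ z, r)) = fun r => g (φ (r, f z)) := by
      simp only [k, hinv]
    rw [h3] at h1
    rw [der_eq_fderiv, ← hσz, h1.fderiv, hσz] at h2
    have h4 := congrArg (fun A : ℝ →L[ℝ] ℝ => A 1) h2
    simp only [ContinuousLinearMap.comp_apply, velocity_apply, one_smul,
      ContinuousLinearMap.inr_apply] at h4
    rw [hσz, h4]
    exact hgw
  have hfin : ContMDiffAt 𝓘(ℝ, E₁) 𝓘(ℝ, ℝ) ∞ (fun y => σ (ψ y)) z :=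
    ContMDiffAt.comp (g := σ) (f := ψ) z (contDiffAt_of_implicit hk hσ hk0 hkd).contMDiffAt
      (contMDiffAt_chart hzs)
  refine hfin.congr_of_eventuallyEq ?_
  filter_upwards [(isOpen_extChartAt_source z).mem_nhds hzs] with y hy
  simp only [σ]
  rw [ψ.left_inv hy]

variable [IsManifold 𝓘(ℝ, E) ∞ M] [T2Space M]

/-- Near any point, the hitting map is the flow, at a time depending on the point, of a transport
map. -/
lemma exists_local_form {β : TwoForm E M} {H : M → ℝ} {w : M → E}
    (hw : ∀ x₀ : M, ContDiffOn ℝ ∞ (fieldInChart w x₀) (extChartAt 𝓘(ℝ, E) x₀).target)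
    (hflow : ∀ q : M, ∃ δ > 0, ∃ V φ, q ∈ V ∧ IsLocalFlow β H w δ V φ)
    {ι : P → M} (hι : Continuous ι) {q : P → M} {τ : P → ℝ} (hτ : Continuous τ)
    (hpos : ∀ z, 0 < τ z)
    (hγ : ∀ z, ∃ γ : ℝ → M, γ 0 = ι z ∧ (∀ r ∈ Icc 0 (τ z), HasMFDerivWithinAt 𝓘(ℝ, ℝ) 𝓘(ℝ, E) γ
      (Icc 0 (τ z)) r (velocity (E := E) (w (γ r)))) ∧ γ (τ z) = q z) (z₀ : P) :
    ∃ δ V φ t U F, IsLocalFlow β H w δ V φ ∧ IsTransport β H w t U F ∧ ι z₀ ∈ U ∧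
      ∀ᶠ z in 𝓝 z₀, F (ι z) ∈ V ∧ τ z - t ∈ Ioo (-δ) δ ∧ q z = φ (τ z - t, F (ι z)) := by
  choose γ h0 hint hend using hγ
  obtain ⟨δ, hδ, V, φ, hqV, hφ⟩ := hflow (q z₀)
  -- A fixed time `t` shortly before the arrival of `z₀`: the transport covers `[0, t]` for all
  -- nearby points, and the variable remainder `τ z - t` is left to one local flow around the end
  -- point.
  have hev : ∀ᶠ t in 𝓝[<] (τ z₀), γ z₀ t ∈ V ∧ t ∈ Icc 0 (τ z₀) ∧ τ z₀ - δ < t ∧ t < τ z₀ := by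
    have hI : Icc 0 (τ z₀) ∈ 𝓝[<] (τ z₀) := Icc_mem_nhdsLT (hpos z₀)
    have hc : γ z₀ ⁻¹' V ∈ 𝓝[Icc 0 (τ z₀)] (τ z₀) :=
      (hint z₀ _ (right_mem_Icc.2 (hpos z₀).le)).1.preimage_mem_nhdsWithin
        (hφ.isOpen.mem_nhds (by rwa [hend]))
    filter_upwards [nhdsWithin_le_iff.2 hI hc, hI, Ioo_mem_nhdsLT (sub_lt_self (τ z₀) hδ)]
      with t h1 h2 h3 using ⟨h1, h2, h3⟩
  obtain ⟨t, htV, ht, htδ, htlt⟩ := hev.exists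
  have hsub : Icc 0 t ⊆ Icc 0 (τ z₀) := Icc_subset_Icc_right htlt.le
  obtain ⟨U, F, hU, hF⟩ := exists_isTransport hw hflow ht.1
    fun r hr => (hint z₀ r (hsub hr)).mono hsub
  have hFz : γ z₀ t = F (ι z₀) := by
    rw [hF.trajectory (γ z₀) _ htlt.le hU (hint z₀), h0]
  rw [h0] at hU
  refine ⟨δ, V, φ, t, U, F, hφ, hF, hU, ?_⟩
  have hFc : ContinuousAt (fun z => F (ι z)) z₀ :=
    ContinuousAt.comp (f := ι) (hF.contMDiffAt hU).continuousAt hι.continuousAt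
  filter_upwards [hι.continuousAt.preimage_mem_nhds (hF.isOpen.mem_nhds hU),
    hFc.preimage_mem_nhds (hφ.isOpen.mem_nhds (hFz ▸ htV)),
    hτ.continuousAt.preimage_mem_nhds (Ioo_mem_nhds htlt (show τ z₀ < t + δ by linarith))]
    with z hzU hzV hzt
  have hzt1 : t < τ z := hzt.1
  have hzt2 : τ z < t + δ := hzt.2
  have h1 : γ z t = F (ι z) := by
    rw [hF.trajectory (γ z) _ hzt1.le (by rw [h0]; exact hzU) (hint z), h0]
  refine ⟨hzV, ⟨by linarith, by linarith⟩, ?_⟩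
  have hsub' : Icc t (τ z) ⊆ Icc 0 (τ z) := Icc_subset_Icc_left ht.1
  rw [← hend, ← h1]
  exact hφ.eq_of_integralCurve hw hzt1.le (by linarith)
    (fun r hr => (hint z r (hsub' hr)).mono hsub') (by rw [h1]; exact hzV)

/-- The map following integral curves from one transverse section of a level of the Hamiltonian to
another one is smooth and symplectic. -/
theorem hitting_map_isSymplecticMap [CompleteSpace E₁] {β : TwoForm E M} {H : M → ℝ} {w : M → E}
    (hw : ∀ x₀ : M, ContDiffOn ℝ ∞ (fieldInChart w x₀) (extChartAt 𝓘(ℝ, E) x₀).target)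
    (hflow : ∀ q : M, ∃ δ > 0, ∃ V φ, q ∈ V ∧ IsLocalFlow β H w δ V φ)
    (hH : ContMDiff 𝓘(ℝ, E) 𝓘(ℝ, ℝ) ∞ H) (hwH : ∀ x u, ev β x (w x) u = - der E ℝ H x u)
    {ι : P → M} (hι : ContMDiff 𝓘(ℝ, E₁) 𝓘(ℝ, E) ∞ ι) {h : ℝ} (hιH : ∀ z, H (ι z) = h)
    {ι₂ : P₂ → M} (hι₂ : IsSmoothEmbedding 𝓘(ℝ, E₂) 𝓘(ℝ, E) ∞ ι₂)
    (htr : ∀ p, w (ι₂ p) ∉ range (der E₂ E ι₂ p))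
    {Q : P → P₂} {τ : P → ℝ} (hτ : Continuous τ) (hpos : ∀ z, 0 < τ z)
    (hγ : ∀ z, ∃ γ : ℝ → M, γ 0 = ι z ∧ (∀ r ∈ Icc 0 (τ z), HasMFDerivWithinAt 𝓘(ℝ, ℝ) 𝓘(ℝ, E) γ
      (Icc 0 (τ z)) r (velocity (E := E) (w (γ r)))) ∧ γ (τ z) = ι₂ (Q z)) :
    IsSymplecticMap (pullback (E := E₁) ι β) (pullback (E := E₂) ι₂ β) Q := by
  have key : ∀ z₀, ContMDiffAt 𝓘(ℝ, E₁) 𝓘(ℝ, E₂) ∞ Q z₀ ∧ ∀ u v,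
      ev β (ι₂ (Q z₀)) (der E₁ E (fun z => ι₂ (Q z)) z₀ u) (der E₁ E (fun z => ι₂ (Q z)) z₀ v) =
        ev β (ι z₀) (der E₁ E ι z₀ u) (der E₁ E ι z₀ v) := by
    intro z₀
    obtain ⟨δ, V, φ, t, U, F, hφ, hF, hU, hloc⟩ := exists_local_form hw hflow hι.continuous hτ
      hpos hγ z₀
    obtain ⟨hV, hs, hQz⟩ := hloc.self_of_nhds
    have himm : IsImmersionAt 𝓘(ℝ, E₂) 𝓘(ℝ, E) ∞ ι₂ (Q z₀) :=
      hι₂.isImmersion.isImmersionAt (Q z₀)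
    have hf : ContMDiffAt 𝓘(ℝ, E₁) 𝓘(ℝ, E) ∞ (fun z => F (ι z)) z₀ :=
      ContMDiffAt.comp z₀ (hF.contMDiffAt hU) hι.contMDiffAt
    have hsc : ContinuousAt (fun z => τ z - t) z₀ := (hτ.sub continuous_const).continuousAt
    have hlocQ : (fun z => ι₂ (Q z)) =ᶠ[𝓝 z₀] fun z => φ (τ z - t, F (ι z)) :=
      hloc.mono fun z hz => hz.2.2
    have hφat := hφ.contMDiffAt hs hV
    -- `ι₂ ∘ Q` is continuous by the local formula, and `ι₂` is an embedding. Continuity of `Q` is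
    -- needed before smoothness, so that `g` vanishes at `ι₂ (Q z)` for all `z` near `z₀`.
    have hQc : ContinuousAt Q z₀ := by
      rw [hι₂.isEmbedding.isInducing.continuousAt_iff]
      refine ContinuousAt.congr ?_ hlocQ.symm
      exact ContinuousAt.comp (f := fun z => (τ z - t, F (ι z))) hφat.continuousAt
        (hsc.prodMk hf.continuousAt)
    obtain ⟨-, hfun⟩ := injective_der_and_exists_function himm
    obtain ⟨g, hg, hgw, hg0⟩ := hfun _ (htr (Q z₀))
    rw [hQz] at hg hgw
    have hsm : ContMDiffAt 𝓘(ℝ, E₁) 𝓘(ℝ, ℝ) ∞ (fun z => τ z - t) z₀ := by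
      refine hφ.contMDiffAt_transit_time hsc hf hs hV hg hgw ?_
      filter_upwards [hlocQ, hQc.eventually hg0] with z h1 h2
      rw [← h1, h2]
    have hιQ : ContMDiffAt 𝓘(ℝ, E₁) 𝓘(ℝ, E) ∞ (fun z => ι₂ (Q z)) z₀ :=
      (ContMDiffAt.comp z₀ hφat (hsm.prodMk hf)).congr_of_eventuallyEq hlocQ
    refine ⟨(ContMDiffAt.iff_comp_isImmersionAt himm).2 ⟨hQc, hιQ⟩, fun u v => ?_⟩
    have hslice := hφ.contMDiffAt_slice hs hV
    set p := φ (τ z₀ - t, F (ι z₀)) with hp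
    set A := der E E (fun x => φ (τ z₀ - t, x)) (F (ι z₀)) with hA
    set B := der E₁ E (fun z => F (ι z)) z₀ with hB
    have hd : ∀ u, der E₁ E (fun z => ι₂ (Q z)) z₀ u =
        A (B u) + der E₁ ℝ (fun z => τ z - t) z₀ u • w p := by
      intro u
      rw [der_congr hlocQ]
      exact hφ.der_comp (hsm.mdifferentiableAt (by simp)) (hf.mdifferentiableAt (by simp)) hs hV u
    have hB' : ∀ u, B u = der E E F (ι z₀) (der E₁ E ι z₀ u) := by
      intro u
      rw [hB, der_comp (g := F) (f := ι) ((hF.contMDiffAt hU).mdifferentiableAt (by simp))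
        (hι.mdifferentiableAt (by simp))]
      rfl
    have hslicef : ContMDiffAt 𝓘(ℝ, E₁) 𝓘(ℝ, E) ∞ (fun z => φ (τ z₀ - t, F (ι z))) z₀ :=
      ContMDiffAt.comp (g := fun x => φ (τ z₀ - t, x)) (f := fun z => F (ι z)) z₀ hslice hf
    -- With the time frozen at `τ z₀ - t`, nearby points of the section still land in the level `h`,
    -- although not necessarily in the image of `ι₂`.
    have hconst : ∀ u, der E ℝ H p (A (B u)) = 0 := by
      intro u
      have h1 : (fun z => H (φ (τ z₀ - t, F (ι z)))) =ᶠ[𝓝 z₀] fun _ => h := by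
        filter_upwards [hloc, hι.continuous.continuousAt.preimage_mem_nhds
          (hF.isOpen.mem_nhds hU)] with z hz hzU
        rw [hφ.hamiltonian _ hz.1 _ hs, hF.hamiltonian _ hzU, hιH]
      have h2 : der E₁ E (fun z => φ (τ z₀ - t, F (ι z))) z₀ = A.comp B :=
        SymplecticSection.der_comp (g := fun x => φ (τ z₀ - t, x)) (f := fun z => F (ι z))
          (hslice.mdifferentiableAt (by simp)) (hf.mdifferentiableAt (by simp))
      have h3 := SymplecticSection.der_comp (g := H) (f := fun z => φ (τ z₀ - t, F (ι z)))
        (hH.mdifferentiableAt (by simp))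
        (hslicef.mdifferentiableAt (by simp))
      rw [der_congr h1, h2] at h3
      have h4 : der E₁ ℝ (fun _ : P => h) z₀ = 0 := mfderiv_const
      rw [h4] at h3
      exact (congrArg (fun L : E₁ →L[ℝ] ℝ => L u) h3).symm
    have hform : ev β p (A (B u)) (A (B v)) =
        ev β (ι z₀) (der E₁ E ι z₀ u) (der E₁ E ι z₀ v) := by
      rw [hB', hB']
      exact (hφ.form _ hV _ hs _ _).trans (hF.form _ hU _ _)
    -- Bilinear expansion: `β(w, w) = 0`, and the cross terms are values of `dH` on `A (B u)` and `A
    -- (B v)`, zero by `hconst`.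
    rw [hQz, hd, hd, ev_add_left, ev_add_right, ev_add_right, ev_smul_left, ev_smul_left,
      ev_smul_right, ev_smul_right, ev_self, hwH, ev_swap β p (w p), hwH, hconst, hconst, hform]
    ring
  refine ⟨fun z => (key z).1, twoForm_ext fun z u v => ?_⟩
  rw [ev_pullback, ev_pullback, ev_pullback, ← (key z).2 u v]
  rw [der_comp (g := ι₂) (f := Q) (hι₂.isImmersion.contMDiff.mdifferentiableAt (by simp))
    ((key z).1.mdifferentiableAt (by simp))]
  rfl

end Hitting

/-! ### Sections are symplectic. -/

section Sections

open Set Filter Topology Manifold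

variable {E : Type*} [NormedAddCommGroup E] [NormedSpace ℝ E] [FiniteDimensional ℝ E]
  {M : Type*} [TopologicalSpace M] [ChartedSpace E M] [IsManifold 𝓘(ℝ, E) ∞ M]
  {E₁ : Type*} [NormedAddCommGroup E₁] [NormedSpace ℝ E₁] [FiniteDimensional ℝ E₁]

/-- A section of codimension 2, transverse to the flow in a level of the Hamiltonian, is
symplectic. -/
theorem IsSection.isSymplecticForm_restrict
    (hdim : Nontrivial E → Module.finrank ℝ E₁ + 2 = Module.finrank ℝ E) {β : TwoForm E M}
    (hβ : IsSymplecticForm β) {H : M → ℝ} (hH : ContMDiff 𝓘(ℝ, E) 𝓘(ℝ, ℝ) ∞ H) {w : M → E}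
    (hw : ∀ x u, ev β x (w x) u = - der E ℝ H x u) {h : ℝ} {Y : Set M} [ChartedSpace E₁ Y]
    [IsManifold 𝓘(ℝ, E₁) ∞ Y] (hY : IsSection E₁ H h w Y) :
    IsSymplecticForm (restrict E₁ β Y) := by
  have hι := hY.isSmoothEmbedding.isImmersion.contMDiff
  refine ⟨isSmoothForm_pullback hι hβ.smooth, isClosedForm_pullback hι hβ.smooth hβ.closed,
    fun z (u : E₁) hu => ?_⟩
  -- Transversality at a point `z` gives `w z ≠ 0`, which excludes dimension zero as soon as `Y` has
  -- a point.
  have hE : Nontrivial E := ⟨w z, 0, fun h0 => hY.transverse z ⟨0, by rw [h0, map_zero]; rfl⟩⟩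
  refine nondegenerate_of_transverse (E₁ := E₁) (α := der E ℝ H z)
    (A := der E₁ E (Subtype.val : Y → M) z) (hdim hE) β z (hβ.nondegenerate z) (hw z)
    (injective_der_and_exists_function (hY.isSmoothEmbedding.isImmersion.isImmersionAt z)).1
    (hY.transverse z) (fun v => ?_) (fun v => ?_)
  · have h1 := der_comp (g := H) (f := (Subtype.val : Y → M)) (x := z)
      (hH.mdifferentiableAt (by simp)) (hι.mdifferentiableAt (by simp))
    have h2 : (fun y : Y => H y) = fun _ => h := funext fun y => hY.subset_level y y.2
    have h3 : der E₁ ℝ (fun _ : Y => h) z = 0 := mfderiv_const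
    rw [h2, h3] at h1
    exact (congrArg (fun L : E₁ →L[ℝ] ℝ => L v) h1).symm
  · exact (ev_pullback (Subtype.val : Y → M) β z u v).symm.trans (hu v)

end Sections

end SymplecticSection

end

/-! ### The theorem for model spaces of dimensions `2m` and `2m - 2`. -/

theorem mainTheorem10 (m : ℕ)
    {N : Type*} [TopologicalSpace N] [T2Space N]
    [ChartedSpace (EuclideanSpace ℝ (Fin (2 * m))) N] [IsManifold (𝓡 (2 * m)) ∞ N]
    (β : SymplecticSection.TwoForm (EuclideanSpace ℝ (Fin (2 * m))) N)
    (hβ : SymplecticSection.IsSymplecticForm β)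
    (H : N → ℝ) (hH : ContMDiff (𝓡 (2 * m)) 𝓘(ℝ, ℝ) ∞ H)
    (w : ∀ z : N, TangentSpace (𝓡 (2 * m)) z)
    (hw : SymplecticSection.IsHamiltonianVectorField β H w)
    (h : ℝ) (hreg : ∀ z : N, H z = h → mvfderiv (𝓡 (2 * m)) H z ≠ 0)
    (Y₁ Y₂ : Set N)
    [ChartedSpace (EuclideanSpace ℝ (Fin (2 * m - 2))) Y₁] [IsManifold (𝓡 (2 * m - 2)) ∞ Y₁]
    [ChartedSpace (EuclideanSpace ℝ (Fin (2 * m - 2))) Y₂] [IsManifold (𝓡 (2 * m - 2)) ∞ Y₂]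
    (hY₁ : SymplecticSection.IsSection (EuclideanSpace ℝ (Fin (2 * m - 2))) H h w Y₁)
    (hY₂ : SymplecticSection.IsSection (EuclideanSpace ℝ (Fin (2 * m - 2))) H h w Y₂)
    (τ : Y₁ → ℝ) (hτ : Continuous τ) (Q : Y₁ → Y₂)
    (hQ : SymplecticSection.IsHittingMap w Y₁ Y₂ τ Q) :
    SymplecticSection.IsSymplecticForm
      (SymplecticSection.restrict (EuclideanSpace ℝ (Fin (2 * m - 2))) β Y₁) ∧
    SymplecticSection.IsSymplecticForm
      (SymplecticSection.restrict (EuclideanSpace ℝ (Fin (2 * m - 2))) β Y₂) ∧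
    SymplecticSection.IsSymplecticMap
      (SymplecticSection.restrict (EuclideanSpace ℝ (Fin (2 * m - 2))) β Y₁)
      (SymplecticSection.restrict (EuclideanSpace ℝ (Fin (2 * m - 2))) β Y₂) Q := by
  have hw' : ∀ x u, SymplecticSection.ev β x (w x) u =
      - SymplecticSection.der (EuclideanSpace ℝ (Fin (2 * m))) ℝ H x u := hw
  -- The subtraction `2 * m - 2` is truncated, so the dimension count fails for `m = 0`;
  -- nontriviality of the model space gives `m ≥ 1`.
  have hdim : Nontrivial (EuclideanSpace ℝ (Fin (2 * m))) →
      Module.finrank ℝ (EuclideanSpace ℝ (Fin (2 * m - 2))) + 2 =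
        Module.finrank ℝ (EuclideanSpace ℝ (Fin (2 * m))) := by
    intro hE
    have hpos := Module.finrank_pos (R := ℝ) (M := EuclideanSpace ℝ (Fin (2 * m)))
    rw [finrank_euclideanSpace_fin] at hpos
    rw [finrank_euclideanSpace_fin, finrank_euclideanSpace_fin]
    omega
  refine ⟨hY₁.isSymplecticForm_restrict hdim hβ hH hw',
    hY₂.isSymplecticForm_restrict hdim hβ hH hw', ?_⟩
  exact SymplecticSection.hitting_map_isSymplecticMap
    (SymplecticSection.contDiffOn_fieldInChart hβ.smooth hβ.nondegenerate hH hw')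
    (SymplecticSection.exists_isLocalFlow hβ.smooth hβ.closed hβ.nondegenerate hH hw') hH hw'
    hY₁.isSmoothEmbedding.isImmersion.contMDiff (fun z => hY₁.subset_level z z.2)
    hY₂.isSmoothEmbedding hY₂.transverse hτ hQ.pos hQ.trajectory
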